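/- Let $(M^n,g)$ be a smooth Riemannian manifold (without boundary) of dimension $n\ge 2$, and let $u:M\to\mathbb{R}$ be a smooth positive function with $$\Delta u^2 = 2n\,|\nabla u|^2 \quad\text{on } M .$$ Let $B=\mathrm{Hess}_{u^2}-2|\nabla u|^2 g$ be the trace-free Hessian of $u^2$. At points where $\nabla u\neq 0$ let $\mathbf n=\nabla u/|\nabla u|$ be the unit normal of the level sets of $u$; let $B(\mathbf n)$ be the tangent vector given by $\langle B(\mathbf n),v\rangle=B(\mathbf n,v)$, and let $B(\mathbf n)^T=B(\mathbf n)-\langle B(\mathbf n),\mathbf n\rangle\,\mathbf n$ be its component tangent to the level set; let $\mathrm{II}(v,w)=\langle\nabla_v\mathbf n,w\rangle$ (for $v,w\perp\mathbf n$) be the second fundamental form of the level set, $H$ its trace, $g_0$ the restriction of $g$ to the level set, and $\mathrm{II}_0=\mathrm{II}-\frac{H}{n-1}g_0$ its trace-free part. For $\beta\in\mathbb{R}$ put $\tilde\beta=1+(\beta-1)(n-1)$. Then for all $q,\beta\in\mathbb{R}$, at every point where $\nabla u\ne 0$, the function $u^{2q}|\nabla u|^\beta$ is smooth near that point, and $$\begin{aligned}\Delta\big(u^{2q}|\nabla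 u|^{\beta}\big)&=2q(2q+n-2)\,u^{2q-2}|\nabla u|^{2+\beta}+\beta\,u^{2q}|\nabla u|^{\beta}\big(|\mathrm{II}_0|^2+\mathrm{Ric}(\mathbf n,\mathbf n)\big)\\&\quad+\frac{\beta}{4(n-1)}\,u^{2q-2}|\nabla u|^{\beta-2}\big(\tilde\beta\,|B(\mathbf n)|^2+(n-2)\,|B(\mathbf n)^T|^2\big)\\&\quad+\beta(2q+n-2)\,u^{2q-2}|\nabla u|^{\beta-1}\langle\nabla|\nabla u|,\nabla u^2\rangle .\end{aligned}$$ In particular (the cases $2q=2-n$ and $q=0$), at every such point, $$\begin{aligned}\Delta\big(u^{2-n}|\nabla u|^{\beta}\big)&=\beta\,u^{2-n}|\nabla u|^{\beta}\big(|\mathrm{II}_0|^2+\mathrm{Ric}(\mathbf n,\mathbf n)\big)\\&\quad+\frac{\beta}{4(n-1)}\,u^{-n}|\nabla u|^{\beta-2}\big(\tilde\beta\,|B(\mathbf n)|^2+(n-2)\,|B(\mathbf n)^T|^2\big),\\\Delta|\nabla u|^{\beta}&=\beta\,|\nabla u|^{\beta}\big(|\mathrm{II}_0|^2+\mathrm{Ric}(\mathbf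 n,\mathbf n)\big)+\beta(n-2)\,u^{-2}|\nabla u|^{\beta-1}\langle\nabla|\nabla u|,\nabla u^2\rangle\\&\quad+\frac{\beta}{4(n-1)}\,u^{-2}|\nabla u|^{\beta-2}\big(\tilde\beta\,|B(\mathbf n)|^2+(n-2)\,|B(\mathbf n)^T|^2\big).\end{aligned}$$ -/

import Mathlib

open Bundle
open scoped Manifold ContDiff RealInnerProductSpace

/-!
Riemannian geometry of a smooth `n`-dimensional manifold `M` without boundary: the tangent spaces
carry the inner products of `RiemannianBundle`, and at each point `p` tensors are computed from
their coordinates in Mathlib's preferred chart `φ = extChartAt (𝓡 n) p`.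
-/

noncomputable section

namespace LevelSetGeometry

/-- The coordinate space `ℝⁿ`. -/
abbrev Coord (n : ℕ) : Type := EuclideanSpace ℝ (Fin n)

/-- The partial derivative `∂ᵢ h` at `y` of a function on `ℝⁿ`. -/
def pd {n : ℕ} (i : Fin n) (h : Coord n → ℝ) (y : Coord n) : ℝ :=
  fderiv ℝ h y (EuclideanSpace.single i 1)

section Coordinates

variable {n : ℕ} {M : Type*} [TopologicalSpace M] [ChartedSpace (Coord n) M]

/-- The inverse `φ⁻¹ : ℝⁿ → M` of the chart at `p`. -/
def param (p : M) (y : Coord n) : M := (extChartAt (𝓡 n) p).symm y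

/-- The coordinate vector field `∂ᵢ` of the chart at `p`, at the point with coordinates `y`. -/
def coordVec (p : M) (i : Fin n) (y : Coord n) : TangentSpace (𝓡 n) (param p y) :=
  mfderiv 𝓘(ℝ, Coord n) (𝓡 n) (param p) y (EuclideanSpace.single i 1 : Coord n)

/-- The `k`-th component, in the chart at `p`, of a tangent vector at a point `x` of the domain
of that chart. -/
def component (p : M) (k : Fin n) {x : M} (v : TangentSpace (𝓡 n) x) : ℝ :=
  let w : Coord n := mfderiv (𝓡 n) 𝓘(ℝ, Coord n) (extChartAt (𝓡 n) p) x v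
  w k

variable [RiemannianBundle (fun x : M ↦ TangentSpace (𝓡 n) x)]

/-- The matrix `g_{ij} = ⟨∂ᵢ, ∂ⱼ⟩` of the metric in the chart at `p`. -/
def metricMatrix (p : M) (y : Coord n) : Matrix (Fin n) (Fin n) ℝ :=
  Matrix.of fun i j ↦ ⟪coordVec p i y, coordVec p j y⟫

/-- The inverse matrix `g^{ij}`. -/
def metricInv (p : M) (y : Coord n) : Matrix (Fin n) (Fin n) ℝ := (metricMatrix p y)⁻¹

/-- The Christoffel symbols of the Levi-Civita connection in the chart at `p`,
`Γ^k_{ij} = ½ ∑ₗ g^{kl} (∂ᵢ g_{jl} + ∂ⱼ g_{il} - ∂ₗ g_{ij})`. -/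
def christoffel (p : M) (k i j : Fin n) (y : Coord n) : ℝ :=
  (1 / 2 : ℝ) * ∑ l, metricInv p y k l *
    (pd i (fun z ↦ metricMatrix p z j l) y + pd j (fun z ↦ metricMatrix p z i l) y
      - pd l (fun z ↦ metricMatrix p z i j) y)

/-- The coordinates `∂ᵢ∂ⱼ f - ∑ₖ Γ^k_{ij} ∂ₖ f` of the Hessian of `f` in the chart at `p`. -/
def hessCoord (p : M) (f : M → ℝ) (i j : Fin n) (y : Coord n) : ℝ :=
  pd i (pd j (fun z ↦ f (param p z))) y
    - ∑ k, christoffel p k i j y * pd k (fun z ↦ f (param p z)) y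

/-- The coordinates
`∑ₖ (∂ₖ Γ^k_{ij} - ∂ⱼ Γ^k_{ik}) + ∑ₖₗ (Γ^k_{kl} Γ^l_{ij} - Γ^k_{jl} Γ^l_{ik})`
of the Ricci tensor in the chart at `p`. -/
def ricciCoord (p : M) (i j : Fin n) (y : Coord n) : ℝ :=
  ∑ k, (pd k (christoffel p k i j) y - pd j (christoffel p k i k) y)
    + ∑ k, ∑ l, (christoffel p k k l y * christoffel p l i j y
      - christoffel p k j l y * christoffel p l i k y)

end Coordinates

section Tensors

variable {n : ℕ} {M : Type*} [TopologicalSpace M] [ChartedSpace (Coord n) M]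

instance instFiniteDimensionalTangentSpace (p : M) :
    FiniteDimensional ℝ (TangentSpace (𝓡 n) p) :=
  inferInstanceAs (FiniteDimensional ℝ (Coord n))

variable [RiemannianBundle (fun x : M ↦ TangentSpace (𝓡 n) x)]

/-- The Hessian `Hess_f (v, w)` at `p`. -/
def hess (f : M → ℝ) (p : M) (v w : TangentSpace (𝓡 n) p) : ℝ :=
  ∑ i, ∑ j, hessCoord p f i j (extChartAt (𝓡 n) p p) * component p i v * component p j w

variable (n) in
/-- The Laplacian `Δf = ∑ᵢⱼ g^{ij} (Hess_f)_{ij}`, the trace of the Hessian. -/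
def laplacian (f : M → ℝ) (p : M) : ℝ :=
  ∑ i, ∑ j, metricInv p (extChartAt (𝓡 n) p p) i j * hessCoord p f i j (extChartAt (𝓡 n) p p)

/-- The Ricci curvature `Ric (v, w)` at `p`. -/
def ricci (p : M) (v w : TangentSpace (𝓡 n) p) : ℝ :=
  ∑ i, ∑ j, ricciCoord p i j (extChartAt (𝓡 n) p p) * component p i v * component p j w

/-- The covariant derivative `∇_v X` at `p` of a vector field `X` along a tangent vector `v`,
`∑ₖ (∑ᵢ vⁱ ∂ᵢ X^k + ∑ᵢⱼ Γ^k_{ij} vⁱ Xʲ) ∂ₖ` in the chart at `p`; its `k`-th component is returned. -/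
def covDerivComponent (X : ∀ x : M, TangentSpace (𝓡 n) x) (p : M) (v : TangentSpace (𝓡 n) p)
    (k : Fin n) : ℝ :=
  ∑ i, component p i v *
      pd i (fun y ↦ component p k (X (param p y))) (extChartAt (𝓡 n) p p)
    + ∑ i, ∑ j, christoffel p k i j (extChartAt (𝓡 n) p p) * component p i v * component p j (X p)

/-- The pairing `⟨∇_v X, w⟩` at `p`, that is, `∑ₖₗ g_{kl} (∇_v X)^k w^l`. -/
def innerCovDeriv (X : ∀ x : M, TangentSpace (𝓡 n) x) (p : M) (v w : TangentSpace (𝓡 n) p) : ℝ :=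
  ∑ k, ∑ l, metricMatrix p (extChartAt (𝓡 n) p p) k l
    * covDerivComponent X p v k * component p l w

/-- The tangent vector which represents a linear form `α` on `T_p M` through the metric. -/
def sharp (p : M) (α : TangentSpace (𝓡 n) p → ℝ) : TangentSpace (𝓡 n) p :=
  ∑ i, α (stdOrthonormalBasis ℝ (TangentSpace (𝓡 n) p) i) •
    stdOrthonormalBasis ℝ (TangentSpace (𝓡 n) p) i

theorem inner_sharp (p : M) (α : TangentSpace (𝓡 n) p →ₗ[ℝ] ℝ) (v : TangentSpace (𝓡 n) p) :
    ⟪sharp p α, v⟫ = α v := by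
  conv_rhs => rw [← (stdOrthonormalBasis ℝ (TangentSpace (𝓡 n) p)).sum_repr' v]
  simp [sharp, sum_inner, inner_smul_left, mul_comm]

variable (n) in
/-- The gradient `∇f`. -/
def grad (f : M → ℝ) (p : M) : TangentSpace (𝓡 n) p :=
  sharp p (fun v ↦ (mfderiv (𝓡 n) 𝓘(ℝ, ℝ) f p v : ℝ))

variable (n) in
/-- The unit normal `𝐧 = ∇u / |∇u|` of the level sets of `u`. -/
def unitNormal (u : M → ℝ) (p : M) : TangentSpace (𝓡 n) p := ‖grad n u p‖⁻¹ • grad n u p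

variable (n) in
/-- The tensor `B = Hess_{u²} - 2 |∇u|² g`. -/
def tensorB (u : M → ℝ) (p : M) (v w : TangentSpace (𝓡 n) p) : ℝ :=
  hess (fun x ↦ u x ^ 2) p v w - 2 * ‖grad n u p‖ ^ 2 * ⟪v, w⟫

variable (n) in
/-- The vector `B(𝐧)`, given by `⟨B(𝐧), v⟩ = B(𝐧, v)`. -/
def vecBn (u : M → ℝ) (p : M) : TangentSpace (𝓡 n) p := sharp p (tensorB n u p (unitNormal n u p))

variable (n) in
/-- The part `B(𝐧)ᵀ` of `B(𝐧)` tangent to the level set. -/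
def vecBnTan (u : M → ℝ) (p : M) : TangentSpace (𝓡 n) p :=
  vecBn n u p - ⟪vecBn n u p, unitNormal n u p⟫ • unitNormal n u p

variable (n) in
/-- The tangent space at `p` of the level set of `u` through `p`, for `∇u(p) ≠ 0`. -/
abbrev levelTangent (u : M → ℝ) (p : M) : Submodule ℝ (TangentSpace (𝓡 n) p) :=
  (Submodule.span ℝ {grad n u p})ᗮ

variable (n) in
/-- The second fundamental form `II (v, w) = ⟨∇_v 𝐧, w⟩` of the level set of `u` through `p`. -/
def secondFF (u : M → ℝ) (p : M) (v w : levelTangent n u p) : ℝ :=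
  innerCovDeriv (unitNormal n u) p (v : TangentSpace (𝓡 n) p) (w : TangentSpace (𝓡 n) p)

variable (n) in
/-- The mean curvature `H`, the trace of `II`. -/
def meanCurv (u : M → ℝ) (p : M) : ℝ :=
  ∑ i, secondFF n u p (stdOrthonormalBasis ℝ (levelTangent n u p) i)
    (stdOrthonormalBasis ℝ (levelTangent n u p) i)

variable (n) in
/-- The trace-free second fundamental form `II₀ = II - H / (n - 1) g₀`. -/
def traceFreeII (u : M → ℝ) (p : M) (v w : levelTangent n u p) : ℝ :=
  secondFF n u p v w - meanCurv n u p / ((n : ℝ) - 1) * ⟪v, w⟫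

variable (n) in
/-- The squared norm `|II₀|²`. -/
def normSqII₀ (u : M → ℝ) (p : M) : ℝ :=
  ∑ i, ∑ j, traceFreeII n u p (stdOrthonormalBasis ℝ (levelTangent n u p) i)
    (stdOrthonormalBasis ℝ (levelTangent n u p) j) ^ 2

end Tensors

end LevelSetGeometry

end

open LevelSetGeometry

namespace LevelSetGeometry

open Filter Topology

/-! ### Calculus of partial derivatives -/

section PartialDerivatives

variable {n : ℕ} {U : Set (Coord n)} {f h : Coord n → ℝ} {y : Coord n}

/-! Write X = ∇u, A = ∇X (the Hessian as a symmetric endomorphism), P = |X|², w = |X|, 𝐧 = X/w and h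
= ⟨A𝐧, 𝐧⟩. The formula is Bochner's identity for P, with Δu eliminated by the equation and tr A²
traded for the geometry of the level sets.

Since Δu² = 2uΔu + 2P, the hypothesis says uΔu = (n-1)P. Differentiating this along X gives X(Δu) =
(n-1)(2⟨AX, X⟩/u - P²/u²), which enters ½ΔP = X(Δu) + Ric(X, X) + tr A². The latter is the
divergence of ∇_X X = ½∇P (`sum_localCovDeriv_localCovDeriv`, `localLaplacian_sq_norm_grad`). The
product and power rules then give the Laplacian of u^{2q} P^{β/2} (`localLaplacian_rpow_mul_rpow`).

The geometric dictionary is: II = w⁻¹A on 𝐧^⊥, because differentiating the factor w⁻¹ of 𝐧 only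
produces a multiple of X (`innerCovDeriv_unitNormal`); ∇w = A𝐧 (`grad_norm_grad`); and B(𝐧) = 2uA𝐧,
because du ⊗ du and |∇u|²g agree when one argument is 𝐧 (`vecBn_eq`). Linear algebra on 𝐧^⊥ gives tr
A² = w²|II₀|² + 2|A𝐧|² - h² + (tr A - h)²/(n-1) (`normSqII₀_eq`). After substitution, (tr A)²/(n-1)
cancels -(n-1)P²/u². The remaining terms linear in h combine into ⟨∇w, ∇u²⟩ with the factor 2q+n-2.
The quadratic ones combine to β|A𝐧|² - (n-2)/(n-1) h², which is the stated expression in B because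
β̃ + (n-2) = β(n-1).

One point is not pure computation: the Laplacian at each point is defined in that point's own
preferred chart, while differentiating uΔu = (n-1)P needs the equation on an open set of a single
chart. Hence the invariance of the Laplacian under coordinate changes (`localLaplacian_comp`,
`laplacian_param`). All other tensors are only evaluated at x, in the chart at x. -/

theorem ContDiffOn.differentiableAt_of_isOpen (hf : ContDiffOn ℝ ∞ f U) (hU : IsOpen U)
    (hy : y ∈ U) : DifferentiableAt ℝ f y :=
  (hf.contDiffAt (hU.mem_nhds hy)).differentiableAt (by simp)

theorem pd_congr (hfh : f =ᶠ[𝓝 y] h) (i : Fin n) : pd i f y = pd i h y := by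
  simp [pd, hfh.fderiv_eq]

theorem pd_congr_on (hU : IsOpen U) (hfh : ∀ z ∈ U, f z = h z) (hy : y ∈ U) (i : Fin n) :
    pd i f y = pd i h y :=
  pd_congr (eventually_of_mem (hU.mem_nhds hy) hfh) i

theorem pd_add (hf : DifferentiableAt ℝ f y) (hh : DifferentiableAt ℝ h y) (i : Fin n) :
    pd i (fun z ↦ f z + h z) y = pd i f y + pd i h y := by
  simp [pd, fderiv_fun_add hf hh]

theorem pd_mul (hf : DifferentiableAt ℝ f y) (hh : DifferentiableAt ℝ h y) (i : Fin n) :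
    pd i (fun z ↦ f z * h z) y = pd i f y * h y + f y * pd i h y := by
  simp [pd, fderiv_fun_mul hf hh]; ring

theorem pd_const_mul (c : ℝ) (hf : DifferentiableAt ℝ f y) (i : Fin n) :
    pd i (fun z ↦ c * f z) y = c * pd i f y := by
  simp [pd, fderiv_const_mul hf]

theorem pd_sum {ι : Type*} (s : Finset ι) {F : ι → Coord n → ℝ}
    (hF : ∀ k ∈ s, DifferentiableAt ℝ (F k) y) (i : Fin n) :
    pd i (fun z ↦ ∑ k ∈ s, F k z) y = ∑ k ∈ s, pd i (F k) y := by
  simp [pd, fderiv_fun_sum hF]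

theorem pd_sum_mul {ι : Type*} [Fintype ι] {F H : ι → Coord n → ℝ}
    (hF : ∀ k, DifferentiableAt ℝ (F k) y) (hH : ∀ k, DifferentiableAt ℝ (H k) y) (i : Fin n) :
    pd i (fun z ↦ ∑ k, F k z * H k z) y
      = ∑ k, (pd i (F k) y * H k y + F k y * pd i (H k) y) := by
  rw [pd_sum _ fun k _ ↦ (hF k).fun_mul (hH k)]
  exact Finset.sum_congr rfl fun k _ ↦ pd_mul (hF k) (hH k) i

theorem pd_comp_real {φ : ℝ → ℝ} {φ' : ℝ} (hφ : HasDerivAt φ φ' (f y))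
    (hf : DifferentiableAt ℝ f y) (i : Fin n) : pd i (fun z ↦ φ (f z)) y = φ' * pd i f y := by
  have := (hφ.comp_hasFDerivAt y hf.hasFDerivAt).fderiv
  simp only [pd]
  rw [show (fun z ↦ φ (f z)) = φ ∘ f from rfl, this]
  simp

theorem fderiv_eq_sum_pd (v : Coord n) : fderiv ℝ f y v = ∑ i, v i * pd i f y := by
  conv_lhs => rw [← (EuclideanSpace.basisFun (Fin n) ℝ).sum_repr v]
  simp [pd]

theorem ContDiffOn.pd (hf : ContDiffOn ℝ ∞ f U) (hU : IsOpen U) (i : Fin n) :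
    ContDiffOn ℝ ∞ (pd i f) U :=
  (hf.fderiv_of_isOpen hU (m := ∞) (by simp)).clm_apply contDiffOn_const

theorem pd_comm (hf : ContDiffOn ℝ ∞ f U) (hU : IsOpen U) (hy : y ∈ U) (i j : Fin n) :
    pd i (pd j f) y = pd j (pd i f) y := by
  have h1 : ∀ a b, LevelSetGeometry.pd a (LevelSetGeometry.pd b f) y
      = fderiv ℝ (fderiv ℝ f) y (EuclideanSpace.single a 1) (EuclideanSpace.single b 1) := by
    intro a b
    have hd : DifferentiableAt ℝ (fderiv ℝ f) y :=
      ((hf.fderiv_of_isOpen hU (m := ∞) (by simp)).contDiffAt (hU.mem_nhds hy)).differentiableAt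
        (by simp)
    have := fderiv_clm_apply hd (differentiableAt_const (EuclideanSpace.single b (1 : ℝ)))
    unfold LevelSetGeometry.pd
    rw [this]
    simp
  rw [h1, h1]
  exact (hf.contDiffAt (hU.mem_nhds hy)).isSymmSndFDerivAt (by
    simpa using WithTop.coe_le_coe.2 (le_top : (2 : ℕ∞) ≤ ⊤)) _ _

end PartialDerivatives

/-! ### A metric on an open subset of `ℝⁿ` -/

section LocalMetric

variable {n : ℕ}

/-- `g` is a smooth field of symmetric invertible matrices on the open set `U`. -/
structure IsLocalMetric (g : Coord n → Matrix (Fin n) (Fin n) ℝ) (U : Set (Coord n)) : Prop where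
  isOpen : IsOpen U
  smooth (i j : Fin n) : ContDiffOn ℝ ∞ (fun y ↦ g y i j) U
  symm {y : Coord n} (hy : y ∈ U) (i j : Fin n) : g y i j = g y j i
  isUnit_det {y : Coord n} (hy : y ∈ U) : IsUnit (g y).det

/-- The Christoffel symbols of a field of matrices. -/
noncomputable def localChristoffel (g : Coord n → Matrix (Fin n) (Fin n) ℝ) (k i j : Fin n)
    (y : Coord n) : ℝ :=
  (1 / 2 : ℝ) * ∑ l, (g y)⁻¹ k l *
    (pd i (fun z ↦ g z j l) y + pd j (fun z ↦ g z i l) y - pd l (fun z ↦ g z i j) y)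

/-- The coordinates of the Hessian with respect to `g`. -/
noncomputable def localHess (g : Coord n → Matrix (Fin n) (Fin n) ℝ) (f : Coord n → ℝ) (i j : Fin n)
    (y : Coord n) : ℝ :=
  pd i (pd j f) y - ∑ k, localChristoffel g k i j y * pd k f y

/-- The Laplacian with respect to `g`. -/
noncomputable def localLaplacian (g : Coord n → Matrix (Fin n) (Fin n) ℝ) (f : Coord n → ℝ)
    (y : Coord n) : ℝ :=
  ∑ i, ∑ j, (g y)⁻¹ i j * localHess g f i j y

/-- The components of the gradient with respect to `g`. -/
noncomputable def localGrad (g : Coord n → Matrix (Fin n) (Fin n) ℝ) (f : Coord n → ℝ) (i : Fin n)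
    (y : Coord n) : ℝ :=
  ∑ j, (g y)⁻¹ i j * pd j f y

/-- The components `∇ₖ Xⁱ` of the covariant derivative of a vector field, for the connection with
symbols `Γ`. -/
noncomputable def localCovDeriv (Γ : Fin n → Fin n → Fin n → Coord n → ℝ) (X : Fin n → Coord n → ℝ)
    (i k : Fin n) (y : Coord n) : ℝ :=
  pd k (X i) y + ∑ l, Γ i k l y * X l y

/-- The components of the Ricci tensor of the connection with symbols `Γ`. -/
noncomputable def localRicci (Γ : Fin n → Fin n → Fin n → Coord n → ℝ) (i j : Fin n)
    (y : Coord n) : ℝ :=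
  ∑ k, (pd k (Γ k i j) y - pd j (Γ k i k) y)
    + ∑ k, ∑ l, (Γ k k l y * Γ l i j y - Γ k j l y * Γ l i k y)

namespace IsLocalMetric

variable {g : Coord n → Matrix (Fin n) (Fin n) ℝ} {U : Set (Coord n)} {f h : Coord n → ℝ}
  {y : Coord n}

theorem inv_symm (hg : IsLocalMetric g U) (hy : y ∈ U) (i j : Fin n) :
    (g y)⁻¹ i j = (g y)⁻¹ j i := by
  have h1 : (g y).transpose = g y := by ext a b; exact hg.symm hy b a
  have h2 := Matrix.transpose_nonsing_inv (g y)
  rw [h1] at h2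
  conv_lhs => rw [← h2]
  rfl

theorem sum_mul_sum_inv_mul (hg : IsLocalMetric g U) (hy : y ∈ U) (i : Fin n) (c : Fin n → ℝ) :
    ∑ k, g y i k * ∑ l, (g y)⁻¹ k l * c l = c i := by
  have := congrFun (Matrix.mulVec_mulVec c (g y) (g y)⁻¹) i
  rw [Matrix.mul_nonsing_inv _ (hg.isUnit_det hy), Matrix.one_mulVec] at this
  simpa [Matrix.mulVec, dotProduct] using this

theorem sum_inv_mul_sum_mul (hg : IsLocalMetric g U) (hy : y ∈ U) (i : Fin n) (c : Fin n → ℝ) :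
    ∑ k, (g y)⁻¹ i k * ∑ l, g y k l * c l = c i := by
  have := congrFun (Matrix.mulVec_mulVec c (g y)⁻¹ (g y)) i
  rw [Matrix.nonsing_inv_mul _ (hg.isUnit_det hy), Matrix.one_mulVec] at this
  simpa [Matrix.mulVec, dotProduct] using this

theorem contDiffOn_det {m : ℕ} {A : Coord n → Matrix (Fin m) (Fin m) ℝ}
    (hA : ∀ i j, ContDiffOn ℝ ∞ (fun y ↦ A y i j) U) : ContDiffOn ℝ ∞ (fun y ↦ (A y).det) U := by
  simp only [Matrix.det_apply]
  exact ContDiffOn.sum fun σ _ ↦ (contDiffOn_prod fun i _ ↦ hA _ _).const_smul _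

/-- Cramer's rule: the entries of the inverse are polynomials in those of g, divided by the
nonvanishing determinant. -/
theorem smooth_inv (hg : IsLocalMetric g U) (i j : Fin n) :
    ContDiffOn ℝ ∞ (fun y ↦ (g y)⁻¹ i j) U := by
  have hadj : ContDiffOn ℝ ∞ (fun y ↦ (g y).adjugate i j) U := by
    simp only [Matrix.adjugate_apply]
    refine contDiffOn_det fun a b ↦ ?_
    simp only [Matrix.updateRow_apply]
    split_ifs
    · exact contDiffOn_const
    · exact hg.smooth a b
  have hdet := (contDiffOn_det hg.smooth).inv fun y hy ↦ (hg.isUnit_det hy).ne_zero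
  refine (hdet.mul hadj).congr fun y hy ↦ ?_
  simp [Matrix.inv_def]

theorem smooth_christoffel (hg : IsLocalMetric g U) (k i j : Fin n) :
    ContDiffOn ℝ ∞ (localChristoffel g k i j) U :=
  contDiffOn_const.mul <| ContDiffOn.sum fun l _ ↦ (hg.smooth_inv k l).mul
    ((((hg.smooth j l).pd hg.isOpen i).add ((hg.smooth i l).pd hg.isOpen j)).sub
      ((hg.smooth i j).pd hg.isOpen l))

theorem smooth_grad (hg : IsLocalMetric g U) (hf : ContDiffOn ℝ ∞ f U) (i : Fin n) :
    ContDiffOn ℝ ∞ (localGrad g f i) U :=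
  ContDiffOn.sum fun j _ ↦ (hg.smooth_inv i j).mul (hf.pd hg.isOpen j)

theorem pd_symm (hg : IsLocalMetric g U) (hy : y ∈ U) (i j k : Fin n) :
    pd k (fun z ↦ g z i j) y = pd k (fun z ↦ g z j i) y :=
  pd_congr_on hg.isOpen (fun _ hz ↦ hg.symm hz i j) hy k

theorem christoffel_symm (hg : IsLocalMetric g U) (hy : y ∈ U) (k i j : Fin n) :
    localChristoffel g k i j y = localChristoffel g k j i y := by
  unfold localChristoffel
  congr 1
  refine Finset.sum_congr rfl fun l _ ↦ ?_
  rw [hg.pd_symm hy i j l, add_comm (pd i _ y)]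

theorem sum_mul_christoffel (hg : IsLocalMetric g U) (hy : y ∈ U) (k i j : Fin n) :
    ∑ m, g y k m * localChristoffel g m i j y = (1 / 2 : ℝ) *
      (pd i (fun z ↦ g z j k) y + pd j (fun z ↦ g z i k) y - pd k (fun z ↦ g z i j) y) := by
  rw [← hg.sum_mul_sum_inv_mul hy k fun l ↦
    (pd i (fun z ↦ g z j l) y + pd j (fun z ↦ g z i l) y - pd l (fun z ↦ g z i j) y),
    Finset.mul_sum]
  refine Finset.sum_congr rfl fun m _ ↦ ?_
  simp only [localChristoffel]
  ring

/-- Metric compatibility, ∇g = 0: in the sum of the two lowered Christoffel symbols all derivatives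
but ∂ₖ g_{ij} cancel. -/
theorem pd_metric (hg : IsLocalMetric g U) (hy : y ∈ U) (i j k : Fin n) :
    pd k (fun z ↦ g z i j) y = ∑ m, g y i m * localChristoffel g m k j y
      + ∑ m, g y j m * localChristoffel g m k i y := by
  rw [hg.sum_mul_christoffel hy, hg.sum_mul_christoffel hy, hg.pd_symm hy j i k,
    hg.pd_symm hy k i j, hg.pd_symm hy k j i]
  ring

theorem sum_mul_grad (hg : IsLocalMetric g U) (hy : y ∈ U) (i : Fin n) :
    ∑ k, g y i k * localGrad g f k y = pd i f y :=
  hg.sum_mul_sum_inv_mul hy i _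

theorem localHess_symm (hg : IsLocalMetric g U) (hf : ContDiffOn ℝ ∞ f U) (hy : y ∈ U)
    (i j : Fin n) : localHess g f i j y = localHess g f j i y := by
  simp only [localHess, pd_comm hf hg.isOpen hy i j, hg.christoffel_symm hy _ i j]

/-- Lowering an index commutes with ∇: differentiate ∂ⱼf = ∑ g_{jk} X^k, X = ∇f, and use ∇g = 0.
This is the passage from the Hessian form to the endomorphism ∇X. -/
theorem localHess_eq_sum (hg : IsLocalMetric g U) (hf : ContDiffOn ℝ ∞ f U) (hy : y ∈ U)
    (i j : Fin n) :
    localHess g f i j y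
      = ∑ l, g y j l * localCovDeriv (localChristoffel g) (localGrad g f) l i y := by
  have hX k := ContDiffOn.differentiableAt_of_isOpen (hg.smooth_grad hf k) hg.isOpen hy
  have hgd a b := ContDiffOn.differentiableAt_of_isOpen (hg.smooth a b) hg.isOpen hy
  have h1 : pd i (pd j f) y = ∑ k, (pd i (fun z ↦ g z j k) y * localGrad g f k y
      + g y j k * pd i (localGrad g f k) y) := by
    rw [pd_congr_on hg.isOpen (fun z hz ↦ (hg.sum_mul_grad (f := f) hz j).symm) hy i,
      pd_sum_mul (F := fun k z ↦ g z j k) (fun k ↦ hgd j k) hX]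
  have h2 : ∑ k, localChristoffel g k i j y * pd k f y
      = ∑ k, (∑ m, g y k m * localChristoffel g m i j y) * localGrad g f k y := by
    simp only [← hg.sum_mul_grad (f := f) hy, Finset.mul_sum, Finset.sum_mul]
    rw [Finset.sum_comm]
    refine Finset.sum_congr rfl fun k _ ↦ Finset.sum_congr rfl fun m _ ↦ ?_
    rw [hg.symm hy m k]; ring
  have h3 : ∑ l, g y j l * ∑ k, localChristoffel g l i k y * localGrad g f k y
      = ∑ k, (∑ m, g y j m * localChristoffel g m i k y) * localGrad g f k y := by
    simp only [Finset.mul_sum, Finset.sum_mul]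
    rw [Finset.sum_comm]
    refine Finset.sum_congr rfl fun k _ ↦ Finset.sum_congr rfl fun m _ ↦ ?_
    ring
  simp only [localHess, localCovDeriv, mul_add, Finset.sum_add_distrib, h2, h3, h1]
  rw [add_comm, ← sub_eq_zero]
  -- Of the two terms of ∂ᵢ g_{jk}, one completes ∂ᵢX^l to the covariant derivative and the other is
  -- the Christoffel correction of the Hessian.
  have h4 : ∑ k, pd i (fun z ↦ g z j k) y * localGrad g f k y
      = ∑ k, (∑ m, g y j m * localChristoffel g m i k y) * localGrad g f k y
        + ∑ k, (∑ m, g y k m * localChristoffel g m i j y) * localGrad g f k y := by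
    rw [← Finset.sum_add_distrib]
    refine Finset.sum_congr rfl fun k _ ↦ ?_
    rw [hg.pd_metric hy]; ring
  rw [h4]; ring

theorem localLaplacian_eq_sum (hg : IsLocalMetric g U) (hf : ContDiffOn ℝ ∞ f U) (hy : y ∈ U) :
    localLaplacian g f y = ∑ i, localCovDeriv (localChristoffel g) (localGrad g f) i i y := by
  unfold localLaplacian
  refine Finset.sum_congr rfl fun i _ ↦ ?_
  simp only [hg.localHess_eq_sum hf hy]
  exact hg.sum_inv_mul_sum_mul hy i _

/-- The derivative of |X|² along ∂ₖ is 2⟨∇ₖX, X⟩, and symmetry of the Hessian turns it into 2⟨∇_X X,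
∂ₖ⟩. So ∇|∇f|² is twice the field whose divergence gives Bochner's formula. -/
theorem pd_sq_norm_grad (hg : IsLocalMetric g U) (hf : ContDiffOn ℝ ∞ f U) (hy : y ∈ U)
    (k : Fin n) :
    pd k (fun z ↦ ∑ i, localGrad g f i z * pd i f z) y
      = 2 * ∑ i, g y k i * ∑ j, localCovDeriv (localChristoffel g) (localGrad g f) i j y
        * localGrad g f j y := by
  have hX k := ContDiffOn.differentiableAt_of_isOpen (hg.smooth_grad hf k) hg.isOpen hy
  have hd k := ContDiffOn.differentiableAt_of_isOpen (hf.pd hg.isOpen k) hg.isOpen hy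
  have hH : ∀ i, pd k (pd i f) y = localHess g f k i y
      + ∑ m, localChristoffel g m k i y * pd m f y := fun i ↦ by simp [localHess]
  have h1 : ∑ i, pd k (localGrad g f i) y * pd i f y
      + ∑ i, localGrad g f i y * ∑ m, localChristoffel g m k i y * pd m f y
      = ∑ i, localCovDeriv (localChristoffel g) (localGrad g f) i k y * pd i f y := by
    simp only [localCovDeriv, add_mul, Finset.sum_add_distrib, add_right_inj, Finset.mul_sum,
      Finset.sum_mul]
    rw [Finset.sum_comm]
    refine Finset.sum_congr rfl fun i _ ↦ Finset.sum_congr rfl fun m _ ↦ ?_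
    ring
  have h2 : ∑ i, localCovDeriv (localChristoffel g) (localGrad g f) i k y * pd i f y
      = ∑ i, localGrad g f i y * localHess g f k i y := by
    simp only [hg.localHess_eq_sum hf hy, ← hg.sum_mul_grad (f := f) hy, Finset.mul_sum]
    rw [Finset.sum_comm]
    refine Finset.sum_congr rfl fun i _ ↦ Finset.sum_congr rfl fun m _ ↦ ?_
    rw [hg.symm hy m i]; ring
  have h3 : ∑ i, localGrad g f i y * localHess g f k i y
      = ∑ i, g y k i * ∑ j, localCovDeriv (localChristoffel g) (localGrad g f) i j y
        * localGrad g f j y := by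
    simp only [hg.localHess_symm hf hy k, hg.localHess_eq_sum hf hy, Finset.mul_sum]
    rw [Finset.sum_comm]
    refine Finset.sum_congr rfl fun i _ ↦ Finset.sum_congr rfl fun m _ ↦ ?_
    ring
  rw [pd_sum_mul hX hd]
  simp only [hH, mul_add, Finset.sum_add_distrib]
  rw [← h3]
  linarith

end IsLocalMetric

theorem sum_comm_pairs {ι : Type*} [Fintype ι] (F : ι → ι → ι → ι → ℝ) :
    ∑ i, ∑ j, ∑ k, ∑ l, F i j k l = ∑ k, ∑ l, ∑ i, ∑ j, F i j k l := by
  simpa only [Fintype.sum_prod_type] using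
    Finset.sum_comm (s := Finset.univ) (t := Finset.univ)
      (f := fun (p q : ι × ι) ↦ F p.1 p.2 q.1 q.2)

theorem sum_comm_three {ι : Type*} [Fintype ι] (F : ι → ι → ι → ℝ) :
    ∑ i, ∑ j, ∑ k, F i j k = ∑ k, ∑ j, ∑ i, F i j k := by
  rw [Finset.sum_comm]
  rw [Finset.sum_congr rfl fun j _ ↦ Finset.sum_comm]
  exact Finset.sum_comm

/-- The algebraic identity behind the commutation formula for covariant derivatives. -/
theorem sum_commutation_identity (x : Fin n → ℝ) (a A : Fin n → Fin n → ℝ)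
    (c : Fin n → Fin n → Fin n → ℝ) (d : Fin n → Fin n → Fin n → Fin n → ℝ)
    (s : Fin n → Fin n → Fin n → ℝ) (hs : ∀ i j k, s i j k = s j i k)
    (hc : ∀ k i j, c k i j = c k j i) (hd : ∀ m k i j, d m k i j = d m k j i)
    (hA : ∀ i k, A i k = a i k + ∑ l, c i k l * x l) :
    ∑ i, (∑ k, ((s i k i + ∑ l, (d i i k l * x l + c i k l * a l i)) * x k + A i k * a k i)
        + ∑ l, c i i l * ∑ k, A l k * x k)
      = ∑ k, x k * ∑ i, (s k i i + ∑ l, (d k i i l * x l + c i i l * a l k))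
        + ∑ i, ∑ j, (∑ k, (d k k i j - d j k i k)
          + ∑ k, ∑ l, (c k k l * c l i j - c k j l * c l i k)) * x i * x j
        + ∑ i, ∑ k, A i k * A k i := by
  -- Here x = X, a = ∂X, A = ∇X, c = Γ, d = ∂Γ, s = ∂∂X. Each identity matches one type of monomial:
  -- s in `e1`, d in `e2` and `e3`, products of c with a in `e6` and `e7`, products of two c's in
  -- `e8` and `e9`; `e4` and `e5` expand A. The d and cc terms left over are exactly the Ricci
  -- tensor.
  have e1 : ∑ i, ∑ k, s i k i * x k = ∑ k, ∑ i, x k * s k i i := by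
    rw [Finset.sum_comm]
    exact Finset.sum_congr rfl fun k _ ↦ Finset.sum_congr rfl fun i _ ↦ by rw [hs]; ring
  have e2 : ∑ i, ∑ k, ∑ l, d i i k l * x l * x k = ∑ i, ∑ j, ∑ k, d k k i j * x i * x j := by
    rw [Finset.sum_comm]
    refine Finset.sum_congr rfl fun k _ ↦ ?_
    rw [Finset.sum_comm]
    exact Finset.sum_congr rfl fun k _ ↦ Finset.sum_congr rfl fun i _ ↦ by ring
  have e3 : ∑ k, ∑ i, ∑ l, x k * (d k i i l * x l) = ∑ i, ∑ j, ∑ k, d j k i k * x i * x j := by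
    symm
    rw [Finset.sum_comm]
    refine Finset.sum_congr rfl fun k _ ↦ ?_
    rw [Finset.sum_comm]
    exact Finset.sum_congr rfl fun k _ ↦ Finset.sum_congr rfl fun i _ ↦ by rw [hd]; ring
  have e4 : ∑ i, ∑ k, A i k * A k i
      = ∑ i, ∑ k, A i k * a k i + ∑ i, ∑ k, ∑ l, a i k * (c k i l * x l)
        + ∑ i, ∑ k, ∑ l, ∑ m, c i k m * x m * (c k i l * x l) := by
    simp only [← Finset.sum_add_distrib]
    refine Finset.sum_congr rfl fun i _ ↦ Finset.sum_congr rfl fun k _ ↦ ?_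
    rw [hA k i, mul_add, add_assoc, add_right_inj, Finset.mul_sum, ← Finset.sum_add_distrib]
    refine Finset.sum_congr rfl fun l _ ↦ ?_
    rw [hA i k, add_mul, Finset.sum_mul]
  have e5 : ∑ i, ∑ l, c i i l * ∑ k, A l k * x k
      = ∑ i, ∑ l, ∑ k, c i i l * (a l k * x k)
        + ∑ i, ∑ l, ∑ k, ∑ m, c i i l * (c l k m * x m * x k) := by
    simp only [← Finset.sum_add_distrib]
    refine Finset.sum_congr rfl fun i _ ↦ Finset.sum_congr rfl fun k _ ↦ ?_
    rw [Finset.mul_sum]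
    refine Finset.sum_congr rfl fun l _ ↦ ?_
    rw [hA, add_mul, mul_add, Finset.sum_mul, Finset.mul_sum]
  have e6 : ∑ i, ∑ k, ∑ l, c i k l * a l i * x k = ∑ i, ∑ k, ∑ l, a i k * (c k i l * x l) := by
    symm
    rw [Finset.sum_comm]
    refine Finset.sum_congr rfl fun i _ ↦ ?_
    rw [Finset.sum_comm]
    exact Finset.sum_congr rfl fun k _ ↦ Finset.sum_congr rfl fun i _ ↦ by rw [hc]; ring
  have e7 : ∑ i, ∑ l, ∑ k, c i i l * (a l k * x k) = ∑ k, ∑ i, ∑ l, x k * (c i i l * a l k) := by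
    symm
    rw [Finset.sum_comm]
    refine Finset.sum_congr rfl fun i _ ↦ ?_
    rw [Finset.sum_comm]
    exact Finset.sum_congr rfl fun l _ ↦ Finset.sum_congr rfl fun k _ ↦ by ring
  have e8 : ∑ i, ∑ l, ∑ k, ∑ m, c i i l * (c l k m * x m * x k)
      = ∑ i, ∑ j, ∑ k, ∑ l, c k k l * c l i j * x i * x j := by
    rw [sum_comm_pairs]
    exact Finset.sum_congr rfl fun i _ ↦ Finset.sum_congr rfl fun j _ ↦
      Finset.sum_congr rfl fun k _ ↦ Finset.sum_congr rfl fun l _ ↦ by ring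
  have e9 : ∑ i, ∑ k, ∑ l, ∑ m, c i k m * x m * (c k i l * x l)
      = ∑ i, ∑ j, ∑ k, ∑ l, c k j l * c l i k * x i * x j := by
    rw [sum_comm_pairs]
    exact Finset.sum_congr rfl fun i _ ↦ Finset.sum_congr rfl fun j _ ↦
      Finset.sum_congr rfl fun k _ ↦ Finset.sum_congr rfl fun l _ ↦ by rw [hc k j, hc l i]; ring
  simp only [Finset.sum_add_distrib, Finset.sum_sub_distrib, add_mul, sub_mul, mul_add,
    Finset.sum_mul, Finset.mul_sum] at *
  linarith

/-- The divergence of `∇_X X` for a symmetric connection. -/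
theorem sum_localCovDeriv_localCovDeriv {Γ : Fin n → Fin n → Fin n → Coord n → ℝ}
    {X : Fin n → Coord n → ℝ} {U : Set (Coord n)} (hU : IsOpen U)
    (hΓ : ∀ k i j, ContDiffOn ℝ ∞ (Γ k i j) U) (hX : ∀ i, ContDiffOn ℝ ∞ (X i) U)
    {y : Coord n} (hy : y ∈ U) (hsymm : ∀ k i j, ∀ z ∈ U, Γ k i j z = Γ k j i z) :
    ∑ i, localCovDeriv Γ (fun i z ↦ ∑ k, localCovDeriv Γ X i k z * X k z) i i y
      = ∑ k, X k y * pd k (fun z ↦ ∑ i, localCovDeriv Γ X i i z) y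
        + ∑ i, ∑ j, localRicci Γ i j y * X i y * X j y
        + ∑ i, ∑ k, localCovDeriv Γ X i k y * localCovDeriv Γ X k i y := by
  have dX i := ContDiffOn.differentiableAt_of_isOpen (hX i) hU hy
  have dΓ k i j := ContDiffOn.differentiableAt_of_isOpen (hΓ k i j) hU hy
  have dX' i j := ContDiffOn.differentiableAt_of_isOpen ((hX i).pd hU j) hU hy
  have dA i k : DifferentiableAt ℝ (localCovDeriv Γ X i k) y :=
    (dX' i k).add (DifferentiableAt.fun_sum fun l _ ↦ (dΓ i k l).mul (dX l))
  have pA (m i k : Fin n) : pd m (localCovDeriv Γ X i k) y = pd m (pd k (X i)) y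
      + ∑ l, (pd m (Γ i k l) y * X l y + Γ i k l y * pd m (X l) y) := by
    unfold localCovDeriv
    rw [pd_add (dX' i k) (DifferentiableAt.fun_sum fun l _ ↦ (dΓ i k l).fun_mul (dX l)),
      pd_sum_mul (dΓ i k) dX]
  have e1 (i : Fin n) : localCovDeriv Γ (fun i z ↦ ∑ k, localCovDeriv Γ X i k z * X k z) i i y
      = ∑ k, (pd i (localCovDeriv Γ X i k) y * X k y + localCovDeriv Γ X i k y * pd i (X k) y)
        + ∑ l, Γ i i l y * ∑ k, localCovDeriv Γ X l k y * X k y := by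
    conv_lhs => unfold localCovDeriv
    congr 1
    change pd i (fun z ↦ ∑ k, localCovDeriv Γ X i k z * X k z) y = _
    rw [pd_sum_mul (dA i) dX]
  simp only [e1, pd_sum _ fun i (_ : i ∈ Finset.univ) ↦ dA i i, pA]
  exact sum_commutation_identity (fun i ↦ X i y) (fun i k ↦ pd k (X i) y)
    (fun i k ↦ localCovDeriv Γ X i k y) (fun k i j ↦ Γ k i j y) (fun m k i j ↦ pd m (Γ k i j) y)
    (fun m k i ↦ pd m (pd k (X i)) y) (fun m k i ↦ pd_comm (hX i) hU hy m k)
    (fun k i j ↦ hsymm k i j y hy) (fun m k i j ↦ pd_congr_on hU (hsymm k i j) hy m)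
    fun i k ↦ rfl

end LocalMetric

namespace IsLocalMetric

variable {n : ℕ} {g : Coord n → Matrix (Fin n) (Fin n) ℝ} {U : Set (Coord n)} {f h : Coord n → ℝ}
  {y : Coord n}

/-! ### Product and chain rules for the Laplacian -/

theorem mono (hg : IsLocalMetric g U) {V : Set (Coord n)} (hV : IsOpen V) (hVU : V ⊆ U) :
    IsLocalMetric g V where
  isOpen := hV
  smooth i j := (hg.smooth i j).mono hVU
  symm hy := hg.symm (hVU hy)
  isUnit_det hy := hg.isUnit_det (hVU hy)

theorem smooth_laplacian (hg : IsLocalMetric g U) (hf : ContDiffOn ℝ ∞ f U) :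
    ContDiffOn ℝ ∞ (localLaplacian g f) U :=
  ContDiffOn.sum fun i _ ↦ ContDiffOn.sum fun j _ ↦ (hg.smooth_inv i j).mul <|
    ((hf.pd hg.isOpen j).pd hg.isOpen i).sub <| ContDiffOn.sum fun k _ ↦
      (hg.smooth_christoffel k i j).mul (hf.pd hg.isOpen k)

theorem localHess_mul (hg : IsLocalMetric g U) (hf : ContDiffOn ℝ ∞ f U)
    (hh : ContDiffOn ℝ ∞ h U) (hy : y ∈ U) (i j : Fin n) :
    localHess g (fun z ↦ f z * h z) i j y = f y * localHess g h i j y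
      + h y * localHess g f i j y + pd i f y * pd j h y + pd j f y * pd i h y := by
  have df {z} (hz : z ∈ U) := hf.differentiableAt_of_isOpen hg.isOpen hz
  have dh {z} (hz : z ∈ U) := hh.differentiableAt_of_isOpen hg.isOpen hz
  have df' := (hf.pd hg.isOpen j).differentiableAt_of_isOpen hg.isOpen hy
  have dh' := (hh.pd hg.isOpen j).differentiableAt_of_isOpen hg.isOpen hy
  unfold localHess
  rw [pd_congr_on hg.isOpen (fun z hz ↦ pd_mul (df hz) (dh hz) j) hy i,
    pd_add (df'.fun_mul (dh hy)) ((df hy).fun_mul dh'), pd_mul df' (dh hy), pd_mul (df hy) dh']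
  simp only [pd_mul (df hy) (dh hy), mul_add, Finset.sum_add_distrib, mul_sub, Finset.mul_sum]
  have h1 : ∑ k, localChristoffel g k i j y * (pd k f y * h y)
      = ∑ k, h y * (localChristoffel g k i j y * pd k f y) :=
    Finset.sum_congr rfl fun k _ ↦ by ring
  have h2 : ∑ k, localChristoffel g k i j y * (f y * pd k h y)
      = ∑ k, f y * (localChristoffel g k i j y * pd k h y) :=
    Finset.sum_congr rfl fun k _ ↦ by ring
  rw [h1, h2]
  ring

theorem localHess_rpow (hg : IsLocalMetric g U) (hf : ContDiffOn ℝ ∞ f U)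
    (hpos : ∀ z ∈ U, 0 < f z) (hy : y ∈ U) (s : ℝ) (i j : Fin n) :
    localHess g (fun z ↦ f z ^ s) i j y = s * f y ^ (s - 1) * localHess g f i j y
      + s * (s - 1) * f y ^ (s - 2) * (pd i f y * pd j f y) := by
  have df {z} (hz : z ∈ U) := hf.differentiableAt_of_isOpen hg.isOpen hz
  have hp {z} (hz : z ∈ U) (t : ℝ) (k : Fin n) :
      pd k (fun z ↦ f z ^ t) z = t * f z ^ (t - 1) * pd k f z :=
    pd_comp_real (φ := fun x ↦ x ^ t) (Real.hasDerivAt_rpow_const (Or.inl (hpos z hz).ne'))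
      (df hz) k
  have df' := (hf.pd hg.isOpen j).differentiableAt_of_isOpen hg.isOpen hy
  have dr : DifferentiableAt ℝ (fun z ↦ f z ^ (s - 1)) y :=
    (df hy).rpow_const (Or.inl (hpos y hy).ne')
  unfold localHess
  rw [pd_congr_on hg.isOpen (fun z hz ↦ hp hz s j) hy i, pd_mul (dr.const_mul s) df',
    pd_const_mul s dr, hp hy, show s - 1 - 1 = s - 2 by ring]
  simp only [hp hy, mul_sub, Finset.mul_sum]
  have h1 : ∑ k, localChristoffel g k i j y * (s * f y ^ (s - 1) * pd k f y)
      = ∑ k, s * f y ^ (s - 1) * (localChristoffel g k i j y * pd k f y) :=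
    Finset.sum_congr rfl fun k _ ↦ by ring
  rw [h1]
  ring

theorem sum_inv_mul_pd_mul_pd (hg : IsLocalMetric g U) (hy : y ∈ U) :
    ∑ i, ∑ j, (g y)⁻¹ i j * (pd i f y * pd j h y) = ∑ i, localGrad g f i y * pd i h y := by
  rw [Finset.sum_comm]
  refine Finset.sum_congr rfl fun i _ ↦ ?_
  rw [localGrad, Finset.sum_mul]
  refine Finset.sum_congr rfl fun j _ ↦ ?_
  rw [hg.inv_symm hy i j]; ring

theorem sum_inv_mul_pd_mul_pd' :
    ∑ i, ∑ j, (g y)⁻¹ i j * (pd j f y * pd i h y) = ∑ i, localGrad g f i y * pd i h y := by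
  refine Finset.sum_congr rfl fun i _ ↦ ?_
  rw [localGrad, Finset.sum_mul]
  refine Finset.sum_congr rfl fun j _ ↦ ?_
  ring

theorem localLaplacian_mul (hg : IsLocalMetric g U) (hf : ContDiffOn ℝ ∞ f U)
    (hh : ContDiffOn ℝ ∞ h U) (hy : y ∈ U) :
    localLaplacian g (fun z ↦ f z * h z) y = f y * localLaplacian g h y
      + h y * localLaplacian g f y + 2 * ∑ i, localGrad g f i y * pd i h y := by
  rw [two_mul]
  nth_rw 1 [← hg.sum_inv_mul_pd_mul_pd hy]
  rw [← sum_inv_mul_pd_mul_pd']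
  simp only [localLaplacian, hg.localHess_mul hf hh hy, mul_add, Finset.sum_add_distrib,
    Finset.mul_sum, mul_left_comm _ ((g y)⁻¹ _ _)]
  ring

theorem localLaplacian_rpow (hg : IsLocalMetric g U) (hf : ContDiffOn ℝ ∞ f U)
    (hpos : ∀ z ∈ U, 0 < f z) (hy : y ∈ U) (s : ℝ) :
    localLaplacian g (fun z ↦ f z ^ s) y = s * f y ^ (s - 1) * localLaplacian g f y
      + s * (s - 1) * f y ^ (s - 2) * ∑ i, localGrad g f i y * pd i f y := by
  rw [← hg.sum_inv_mul_pd_mul_pd hy]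
  simp only [localLaplacian, hg.localHess_rpow hf hpos hy, mul_add, Finset.sum_add_distrib,
    Finset.mul_sum, mul_left_comm _ ((g y)⁻¹ _ _)]

/-! ### The Bochner formula -/

theorem smooth_sq_norm_grad (hg : IsLocalMetric g U) (hf : ContDiffOn ℝ ∞ f U) :
    ContDiffOn ℝ ∞ (fun z ↦ ∑ i, localGrad g f i z * pd i f z) U :=
  ContDiffOn.sum fun i _ ↦ (hg.smooth_grad hf i).mul (hf.pd hg.isOpen i)

theorem grad_sq_norm_grad (hg : IsLocalMetric g U) (hf : ContDiffOn ℝ ∞ f U) (hy : y ∈ U)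
    (i : Fin n) :
    localGrad g (fun z ↦ ∑ i, localGrad g f i z * pd i f z) i y
      = 2 * ∑ j, localCovDeriv (localChristoffel g) (localGrad g f) i j y * localGrad g f j y := by
  rw [localGrad]
  simp only [hg.pd_sq_norm_grad hf hy]
  rw [← hg.sum_inv_mul_sum_mul hy i fun i ↦
    ∑ j, localCovDeriv (localChristoffel g) (localGrad g f) i j y * localGrad g f j y,
    Finset.mul_sum]
  exact Finset.sum_congr rfl fun j _ ↦ by ring

/-- Bochner's formula: Δ|∇f|² is the divergence of 2∇_X X with X = ∇f, and div X = Δf. -/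
theorem localLaplacian_sq_norm_grad (hg : IsLocalMetric g U) (hf : ContDiffOn ℝ ∞ f U)
    (hy : y ∈ U) :
    localLaplacian g (fun z ↦ ∑ i, localGrad g f i z * pd i f z) y
      = 2 * (∑ k, localGrad g f k y * pd k (localLaplacian g f) y
        + ∑ i, ∑ j, localRicci (localChristoffel g) i j y * localGrad g f i y * localGrad g f j y
        + ∑ i, ∑ k, localCovDeriv (localChristoffel g) (localGrad g f) i k y
          * localCovDeriv (localChristoffel g) (localGrad g f) k i y) := by
  have hX := hg.smooth_grad hf
  have hA i j : ContDiffOn ℝ ∞ (localCovDeriv (localChristoffel g) (localGrad g f) i j) U :=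
    ((hX i).pd hg.isOpen j).add <| ContDiffOn.sum fun l _ ↦
      (hg.smooth_christoffel i j l).mul (hX l)
  have hY i : ContDiffOn ℝ ∞ (fun z ↦ ∑ j, localCovDeriv (localChristoffel g) (localGrad g f) i j z
      * localGrad g f j z) U := ContDiffOn.sum fun j _ ↦ (hA i j).mul (hX j)
  have h1 : ∀ k, pd k (localLaplacian g f) y
      = pd k (fun z ↦ ∑ i, localCovDeriv (localChristoffel g) (localGrad g f) i i z) y :=
    fun k ↦ pd_congr_on hg.isOpen (fun z hz ↦ hg.localLaplacian_eq_sum hf hz) hy k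
  simp only [h1]
  rw [← sum_localCovDeriv_localCovDeriv hg.isOpen hg.smooth_christoffel hX hy
    fun k i j z hz ↦ hg.christoffel_symm hz k i j,
    hg.localLaplacian_eq_sum (hg.smooth_sq_norm_grad hf) hy, Finset.mul_sum]
  refine Finset.sum_congr rfl fun i _ ↦ ?_
  rw [localCovDeriv, pd_congr_on hg.isOpen (fun z hz ↦ hg.grad_sq_norm_grad hf hz i) hy i,
    pd_const_mul 2 ((hY i).differentiableAt_of_isOpen hg.isOpen hy)]
  simp only [hg.grad_sq_norm_grad hf hy, mul_left_comm _ (2 : ℝ), ← Finset.mul_sum, ← mul_add]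
  rfl

/-- The product rule Δu² = 2uΔu + 2|∇u|² makes the hypothesis a formula for Δu. -/
theorem mul_localLaplacian_of_sq (hg : IsLocalMetric g U) {u : Coord n → ℝ}
    (hu : ContDiffOn ℝ ∞ u U) (hy : y ∈ U)
    (heq : localLaplacian g (fun z ↦ u z ^ 2) y = 2 * n * ∑ i, localGrad g u i y * pd i u y) :
    u y * localLaplacian g u y = (n - 1) * ∑ i, localGrad g u i y * pd i u y := by
  simp only [pow_two] at heq
  rw [hg.localLaplacian_mul hu hu hy] at heq
  linarith

theorem localLaplacian_congr (hU : IsOpen U) (h1 : ∀ z ∈ U, f z = h z) (hy : y ∈ U) :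
    localLaplacian g f y = localLaplacian g h y := by
  simp only [localLaplacian, localHess, fun i j ↦
    pd_congr_on hU (fun z hz ↦ pd_congr_on hU h1 hz j) hy i, pd_congr_on hU h1 hy]

/-- The Laplacian of `u ^ (2 * q) * |∇u| ^ (2 * s)` when `Δu² = 2n |∇u|²`, in terms of
`A = ∇∇u`, `P = |∇u|²` and `Y = A (∇u)`. -/
theorem localLaplacian_rpow_mul_rpow (hg : IsLocalMetric g U) {u P : Coord n → ℝ}
    (hu : ContDiffOn ℝ ∞ u U) (hpos : ∀ z ∈ U, 0 < u z)
    (hP : ∀ z, P z = ∑ i, localGrad g u i z * pd i u z) (hPpos : ∀ z ∈ U, 0 < P z)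
    (heq : ∀ z ∈ U, localLaplacian g (fun z ↦ u z ^ 2) z = 2 * n * P z) (hy : y ∈ U)
    {A : Fin n → Fin n → ℝ}
    (hA : ∀ i j, A i j = localCovDeriv (localChristoffel g) (localGrad g u) i j y)
    {Y : Fin n → ℝ} (hY : ∀ i, Y i = ∑ j, A i j * localGrad g u j y) (q s : ℝ) :
    localLaplacian g (fun z ↦ u z ^ (2 * q) * P z ^ s) y
      = u y ^ (2 * q) * (s * P y ^ (s - 1) * (2 * (
          (n - 1) * (2 * (∑ i, Y i * pd i u y) / u y - P y ^ 2 / u y ^ 2)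
          + ∑ i, ∑ j, localRicci (localChristoffel g) i j y * localGrad g u i y * localGrad g u j y
          + ∑ i, ∑ k, A i k * A k i))
          + s * (s - 1) * P y ^ (s - 2) * (4 * ∑ i, ∑ j, g y i j * Y i * Y j))
        + P y ^ s * (2 * q * u y ^ (2 * q - 1) * ((n - 1) * P y / u y)
          + 2 * q * (2 * q - 1) * u y ^ (2 * q - 2) * P y)
        + 8 * q * s * u y ^ (2 * q - 1) * P y ^ (s - 1) * ∑ i, Y i * pd i u y := by
  obtain rfl : P = fun z ↦ ∑ i, localGrad g u i z * pd i u z := funext hP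
  clear hP
  set P : Coord n → ℝ := fun z ↦ ∑ i, localGrad g u i z * pd i u z with hP
  have sP : ContDiffOn ℝ ∞ P U := hg.smooth_sq_norm_grad hu
  have du := hu.differentiableAt_of_isOpen hg.isOpen hy
  have dP := sP.differentiableAt_of_isOpen hg.isOpen hy
  have gP i : localGrad g P i y = 2 * Y i := by
    rw [hP, hg.grad_sq_norm_grad hu hy]; simp only [hY, hA]
  have pP i : pd i P y = 2 * ∑ j, g y i j * Y j := by
    rw [hP, hg.pd_sq_norm_grad hu hy]; simp only [hY, hA]
  have hlap : ∀ z ∈ U, u z * localLaplacian g u z = (n - 1) * P z :=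
    fun z hz ↦ hg.mul_localLaplacian_of_sq hu hz (heq z hz)
  have hT : ∑ k, localGrad g u k y * pd k P y = 2 * ∑ i, Y i * pd i u y := by
    simp only [pP, ← hg.sum_mul_grad (f := u) hy, Finset.mul_sum]
    rw [Finset.sum_comm]
    refine Finset.sum_congr rfl fun i _ ↦ Finset.sum_congr rfl fun j _ ↦ ?_
    rw [hg.symm hy i j]; ring
  -- The equation uΔu = (n-1)P differentiated along ∇u. This is where it is needed on an open set
  -- and not only at y.
  have hQ : P y * localLaplacian g u y
      + u y * ∑ k, localGrad g u k y * pd k (localLaplacian g u) y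
      = (n - 1) * (2 * ∑ i, Y i * pd i u y) := by
    have dL := (hg.smooth_laplacian hu).differentiableAt_of_isOpen hg.isOpen hy
    have h1 k : pd k u y * localLaplacian g u y + u y * pd k (localLaplacian g u) y
        = (n - 1) * pd k P y := by
      rw [← pd_mul du dL, ← pd_const_mul _ dP, pd_congr_on hg.isOpen hlap hy]
    rw [← hT]
    simp only [hP, Finset.mul_sum, Finset.sum_mul, ← Finset.sum_add_distrib]
    refine Finset.sum_congr rfl fun k _ ↦ ?_
    linear_combination localGrad g u k y * h1 k
  have hN : ∑ i, localGrad g P i y * pd i P y = 4 * ∑ i, ∑ j, g y i j * Y i * Y j := by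
    simp only [gP, pP, Finset.mul_sum]
    exact Finset.sum_congr rfl fun i _ ↦ Finset.sum_congr rfl fun j _ ↦ by ring
  have su : ContDiffOn ℝ ∞ (fun z ↦ u z ^ (2 * q)) U :=
    hu.rpow_const_of_ne fun z hz ↦ (hpos z hz).ne'
  have sPs : ContDiffOn ℝ ∞ (fun z ↦ P z ^ s) U := sP.rpow_const_of_ne fun z hz ↦ (hPpos z hz).ne'
  have hcross : ∑ i, localGrad g (fun z ↦ u z ^ (2 * q)) i y * pd i (fun z ↦ P z ^ s) y
      = 4 * q * s * u y ^ (2 * q - 1) * P y ^ (s - 1) * ∑ i, Y i * pd i u y := by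
    have p1 i : pd i (fun z ↦ P z ^ s) y = s * P y ^ (s - 1) * pd i P y :=
      pd_comp_real (φ := fun x ↦ x ^ s) (Real.hasDerivAt_rpow_const (Or.inl (hPpos y hy).ne')) dP i
    have p2 i : pd i (fun z ↦ u z ^ (2 * q)) y = 2 * q * u y ^ (2 * q - 1) * pd i u y :=
      pd_comp_real (φ := fun x ↦ x ^ (2 * q))
        (Real.hasDerivAt_rpow_const (Or.inl (hpos y hy).ne')) du i
    have g2 i : localGrad g (fun z ↦ u z ^ (2 * q)) i y
        = 2 * q * u y ^ (2 * q - 1) * localGrad g u i y := by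
      simp only [localGrad, p2, Finset.mul_sum]
      exact Finset.sum_congr rfl fun i _ ↦ by ring
    calc _ = 2 * q * u y ^ (2 * q - 1) * (s * P y ^ (s - 1))
            * ∑ k, localGrad g u k y * pd k P y := by
          simp only [p1, g2, Finset.mul_sum]
          exact Finset.sum_congr rfl fun i _ ↦ by ring
      _ = _ := by rw [hT]; ring
  have hu0 := (hpos y hy).ne'
  have hl : localLaplacian g u y = (n - 1) * P y / u y := by
    rw [← hlap y hy]; field_simp
  have hQ' : ∑ k, localGrad g u k y * pd k (localLaplacian g u) y
      = (n - 1) * (2 * (∑ i, Y i * pd i u y) / u y - P y ^ 2 / u y ^ 2) := by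
    rw [hl] at hQ
    field_simp at hQ ⊢
    linarith
  rw [hg.localLaplacian_mul su sPs hy, hcross, hg.localLaplacian_rpow sP hPpos hy, hN,
    hg.localLaplacian_rpow hu hpos hy, hl, hP, hg.localLaplacian_sq_norm_grad hu hy, hQ']
  simp only [hA, hP]
  ring

end IsLocalMetric

/-! ### Invariance of the Laplacian under a change of coordinates -/

section ChangeOfCoordinates

/-- The logarithmic derivative of det G = (det J)² det G', with the derivatives of the three
matrices as free variables. -/
theorem trace_inv_mul_pullback {ι : Type*} [Fintype ι] [DecidableEq ι]
    {G G' J dG dG' dJ : Matrix ι ι ℝ} (hG' : IsUnit G'.det) (hJ : IsUnit J.det)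
    (hG : G = J.transpose * G' * J)
    (hdG : dG = dJ.transpose * G' * J + J.transpose * G' * dJ + J.transpose * dG' * J) :
    (G⁻¹ * dG).trace = 2 * (J⁻¹ * dJ).trace + (G'⁻¹ * dG').trace := by
  have hJt : IsUnit J.transpose.det := by rwa [Matrix.det_transpose]
  have hinv : G⁻¹ = J⁻¹ * (G'⁻¹ * J.transpose⁻¹) := by
    rw [hG, Matrix.mul_inv_rev, Matrix.mul_inv_rev]
  have e1 : (G⁻¹ * (dJ.transpose * G' * J)).trace = (J⁻¹ * dJ).trace := by
    calc (G⁻¹ * (dJ.transpose * G' * J)).trace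
        = (J⁻¹ * (G'⁻¹ * J.transpose⁻¹ * dJ.transpose * G' * J)).trace := by
          rw [hinv]; simp only [Matrix.mul_assoc]
      _ = (G'⁻¹ * (J.transpose⁻¹ * dJ.transpose * G')).trace := by
          rw [Matrix.trace_mul_comm]; simp only [Matrix.mul_assoc]
          rw [Matrix.mul_nonsing_inv _ hJ, Matrix.mul_one]
      _ = (J.transpose⁻¹ * dJ.transpose).trace := by
          rw [Matrix.trace_mul_comm, Matrix.mul_assoc _ G', Matrix.mul_nonsing_inv _ hG',
            Matrix.mul_one]
      _ = (J⁻¹ * dJ).trace := by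
          rw [← Matrix.transpose_nonsing_inv, ← Matrix.transpose_mul, Matrix.trace_transpose,
            Matrix.trace_mul_comm]
  have e2 : G⁻¹ * (J.transpose * G' * dJ) = J⁻¹ * dJ := by
    rw [hinv]
    calc _ = J⁻¹ * (G'⁻¹ * ((J.transpose⁻¹ * J.transpose) * G') * dJ) := by
          simp only [Matrix.mul_assoc]
      _ = _ := by
          rw [Matrix.nonsing_inv_mul _ hJt, Matrix.one_mul, Matrix.nonsing_inv_mul _ hG',
            Matrix.one_mul]
  have e3 : (G⁻¹ * (J.transpose * dG' * J)).trace = (G'⁻¹ * dG').trace := by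
    rw [hinv]
    calc _ = (J⁻¹ * (G'⁻¹ * ((J.transpose⁻¹ * J.transpose) * dG') * J)).trace := by
          simp only [Matrix.mul_assoc]
      _ = _ := by
          rw [Matrix.nonsing_inv_mul _ hJt, Matrix.one_mul, Matrix.trace_mul_comm,
            Matrix.mul_assoc, Matrix.mul_nonsing_inv _ hJ, Matrix.mul_one]
  rw [hdG, Matrix.mul_add, Matrix.mul_add, Matrix.trace_add, Matrix.trace_add, e1, e2, e3]
  ring

/-- The divergence part of the coordinate change: S and T will be the Jacobians of the gradient in
the two coordinate systems, dJ the derivative of J along the gradient. The defect tr(J⁻¹dJ) is the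
one that half of `trace_inv_mul_pullback` compensates. -/
theorem trace_conj_of_add_mul_eq {ι : Type*} [Fintype ι] [DecidableEq ι] {J dJ S T : Matrix ι ι ℝ}
    (hJ : IsUnit J.det) (h : dJ + J * S = T * J) : S.trace = T.trace - (J⁻¹ * dJ).trace := by
  have h1 : J⁻¹ * dJ + S = J⁻¹ * (T * J) := by
    rw [← h, Matrix.mul_add, ← Matrix.mul_assoc, Matrix.nonsing_inv_mul _ hJ, Matrix.one_mul]
  have h2 := congrArg Matrix.trace h1
  rw [Matrix.trace_add, Matrix.trace_mul_comm _ (T * J), Matrix.mul_assoc,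
    Matrix.mul_nonsing_inv _ hJ, Matrix.mul_one] at h2
  linarith

variable {n : ℕ} {g g' : Coord n → Matrix (Fin n) (Fin n) ℝ} {U V : Set (Coord n)}
  {y : Coord n}

/-- The formula Δf = ∂ᵢXⁱ + X(log √|det g|), X = ∇f, with the logarithmic derivative written as ½
tr(g⁻¹ X(g)). No second derivatives of the coordinate change beyond the derivative of its Jacobian
then occur. -/
theorem IsLocalMetric.localLaplacian_eq_divergence (hg : IsLocalMetric g U) {f : Coord n → ℝ}
    (hf : ContDiffOn ℝ ∞ f U) (hy : y ∈ U) :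
    localLaplacian g f y = ∑ i, pd i (localGrad g f i) y
      + (1 / 2) * ∑ i, ∑ j, (g y)⁻¹ i j * ∑ k, localGrad g f k y * pd k (fun z ↦ g z j i) y := by
  have h1 : ∀ l, ∑ i, localChristoffel g i i l y
      = (1 / 2) * ∑ i, ∑ m, (g y)⁻¹ i m * pd l (fun z ↦ g z m i) y := by
    intro l
    -- In Γⁱ_{il} two of the three derivatives of g are exchanged by swapping the summation indices,
    -- and cancel.
    have h2 : ∑ i, ∑ m, (g y)⁻¹ i m * pd m (fun z ↦ g z i l) y
        = ∑ i, ∑ m, (g y)⁻¹ i m * pd i (fun z ↦ g z l m) y := by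
      rw [Finset.sum_comm]
      refine Finset.sum_congr rfl fun i _ ↦ Finset.sum_congr rfl fun m _ ↦ ?_
      rw [hg.inv_symm hy m i, hg.pd_symm hy m l]
    simp only [localChristoffel, mul_add, mul_sub, Finset.sum_add_distrib, Finset.sum_sub_distrib,
      ← Finset.mul_sum, h2, hg.pd_symm hy _ _ l]
    rw [add_sub_cancel_left]
  rw [hg.localLaplacian_eq_sum hf hy]
  simp only [localCovDeriv, Finset.sum_add_distrib, add_right_inj]
  rw [Finset.sum_comm]
  simp only [← Finset.sum_mul, h1]
  simp only [Finset.sum_mul, Finset.mul_sum]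
  rw [Finset.sum_comm]
  refine Finset.sum_congr rfl fun i _ ↦ ?_
  rw [Finset.sum_comm]
  exact Finset.sum_congr rfl fun j _ ↦ Finset.sum_congr rfl fun k _ ↦ by ring

/-- The `(i, a)` entry of the Jacobian matrix of a map of `ℝⁿ`. -/
noncomputable def jacobian (F : Coord n → Coord n) (y : Coord n) : Matrix (Fin n) (Fin n) ℝ :=
  Matrix.of fun i a ↦ pd a (fun z ↦ F z i) y

theorem pd_comp {F : Coord n → Coord n} {h : Coord n → ℝ} (hF : DifferentiableAt ℝ F y)
    (hh : DifferentiableAt ℝ h (F y)) (a : Fin n) :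
    pd a (fun z ↦ h (F z)) y = ∑ i, jacobian F y i a * pd i h (F y) := by
  have h1 : ∀ i, pd a (fun z ↦ F z i) y = fderiv ℝ F y (EuclideanSpace.single a 1) i := by
    intro i
    have := ((EuclideanSpace.proj (𝕜 := ℝ) i).hasFDerivAt.comp y hF.hasFDerivAt).fderiv
    simp only [pd]
    rw [show (fun z ↦ F z i) = (EuclideanSpace.proj (𝕜 := ℝ) i) ∘ F from rfl, this]
    rfl
  simp only [jacobian, Matrix.of_apply, h1]
  rw [← fderiv_eq_sum_pd, pd, show (fun z ↦ h (F z)) = h ∘ F from rfl, fderiv_comp y hh hF]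
  rfl

/-- In the divergence form, the change of ∂ᵢXⁱ is -tr(J⁻¹ X(J)) and that of ½ tr(g⁻¹ X(g)) is
+tr(J⁻¹ X(J)), so the sum is invariant. -/
theorem IsLocalMetric.localLaplacian_comp (hg : IsLocalMetric g V) (hg' : IsLocalMetric g' U)
    {F : Coord n → Coord n} (hF : ContDiffOn ℝ ∞ F V) (hFV : Set.MapsTo F V U)
    (hgF : ∀ z ∈ V, g z = (jacobian F z).transpose * g' (F z) * jacobian F z)
    {f f' : Coord n → ℝ} (hf' : ContDiffOn ℝ ∞ f' U) (hf : ∀ z ∈ V, f z = f' (F z)) (hy : y ∈ V) :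
    localLaplacian g f y = localLaplacian g' f' (F y) := by
  have hV := hg.isOpen
  have hU := hg'.isOpen
  have sf : ContDiffOn ℝ ∞ f V := (hf'.comp hF hFV).congr hf
  have dF {z} (hz : z ∈ V) : DifferentiableAt ℝ F z :=
    (hF.contDiffAt (hV.mem_nhds hz)).differentiableAt (by simp)
  have sFi i : ContDiffOn ℝ ∞ (fun z ↦ F z i) V :=
    (contDiff_euclidean.1 contDiff_id i).comp_contDiffOn hF
  have sJ i a : ContDiffOn ℝ ∞ (fun z ↦ jacobian F z i a) V := (sFi i).pd hV a
  have dJ i a := (sJ i a).differentiableAt_of_isOpen hV hy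
  have dg' i j := (hg'.smooth i j).differentiableAt_of_isOpen hU (hFV hy)
  have dg'F i j : DifferentiableAt ℝ (fun z ↦ g' (F z) i j) y := (dg' i j).comp y (dF hy)
  -- F need not be assumed a local diffeomorphism: det J divides det g, which is a unit.
  have hJ {z} (hz : z ∈ V) : IsUnit (jacobian F z).det := by
    have h1 := hg.isUnit_det hz
    rw [hgF z hz, Matrix.det_mul] at h1
    exact isUnit_of_mul_isUnit_right h1
  -- The two gradients are F-related.
  have hX {z} (hz : z ∈ V) (i : Fin n) :
      ∑ a, jacobian F z i a * localGrad g f a z = localGrad g' f' i (F z) := by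
    have h1 : ∀ a, pd a f z = ∑ i, jacobian F z i a * pd i f' (F z) := fun a ↦ by
      rw [pd_congr_on hV hf hz, pd_comp (dF hz) (hf'.differentiableAt_of_isOpen hU (hFV hz))]
    have h2 : (fun a ↦ pd a f z) = (jacobian F z).transpose.mulVec fun i ↦ pd i f' (F z) := by
      ext a; rw [h1]; rfl
    change (jacobian F z).mulVec ((g z)⁻¹.mulVec fun a ↦ pd a f z) i
      = (g' (F z))⁻¹.mulVec (fun i ↦ pd i f' (F z)) i
    rw [h2, Matrix.mulVec_mulVec, Matrix.mulVec_mulVec, hgF z hz, Matrix.mul_inv_rev,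
      Matrix.mul_inv_rev]
    congr 2
    have hJt : IsUnit (jacobian F z).transpose.det := by rw [Matrix.det_transpose]; exact hJ hz
    calc _ = (jacobian F z * (jacobian F z)⁻¹) * (g' (F z))⁻¹
          * ((jacobian F z).transpose⁻¹ * (jacobian F z).transpose) := by
          simp only [Matrix.mul_assoc]
      _ = _ := by
          rw [Matrix.nonsing_inv_mul _ hJt, Matrix.mul_nonsing_inv _ (hJ hz), Matrix.one_mul,
            Matrix.mul_one]
  have dX i := (hg.smooth_grad sf i).differentiableAt_of_isOpen hV hy
  have dX' i := (hg'.smooth_grad hf' i).differentiableAt_of_isOpen hU (hFV hy)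
  set DJ : Matrix (Fin n) (Fin n) ℝ := Matrix.of fun i a ↦
    ∑ c, localGrad g f c y * pd c (fun z ↦ jacobian F z i a) y with hDJ
  set DG : Matrix (Fin n) (Fin n) ℝ := Matrix.of fun a b ↦
    ∑ c, localGrad g f c y * pd c (fun z ↦ g z a b) y with hDG
  set DG' : Matrix (Fin n) (Fin n) ℝ := Matrix.of fun i j ↦
    ∑ k, localGrad g' f' k (F y) * pd k (fun z ↦ g' z i j) (F y) with hDG'
  have hchain {h : Coord n → ℝ} (hh : DifferentiableAt ℝ h (F y)) :
      ∑ c, localGrad g f c y * pd c (fun z ↦ h (F z)) y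
        = ∑ k, localGrad g' f' k (F y) * pd k h (F y) := by
    simp only [pd_comp (dF hy) hh, ← hX hy, Finset.mul_sum, Finset.sum_mul]
    rw [Finset.sum_comm]
    exact Finset.sum_congr rfl fun i _ ↦ Finset.sum_congr rfl fun m _ ↦ by ring
  have hdG : DG = DJ.transpose * g' (F y) * jacobian F y
      + (jacobian F y).transpose * g' (F y) * DJ
      + (jacobian F y).transpose * DG' * jacobian F y := by
    ext a b
    have h1 : ∀ z ∈ V, g z a b
        = ∑ j, (∑ i, jacobian F z i a * g' (F z) i j) * jacobian F z j b := by
      intro z hz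
      rw [hgF z hz]; rfl
    have d1 j : DifferentiableAt ℝ (fun z ↦ ∑ i, jacobian F z i a * g' (F z) i j) y :=
      DifferentiableAt.fun_sum fun i _ ↦ (dJ i a).fun_mul (dg'F i j)
    have h2 c : pd c (fun z ↦ g z a b) y
        = ∑ j, ((∑ i, (pd c (fun z ↦ jacobian F z i a) y * g' (F y) i j
            + jacobian F y i a * pd c (fun z ↦ g' (F z) i j) y)) * jacobian F y j b
          + (∑ i, jacobian F y i a * g' (F y) i j) * pd c (fun z ↦ jacobian F z j b) y) := by
      rw [pd_congr_on hV h1 hy, pd_sum_mul d1 (fun j ↦ dJ j b)]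
      simp only [pd_sum_mul (fun i ↦ dJ i a) (fun i ↦ dg'F i _)]
    simp only [hDG, hDJ, hDG', Matrix.of_apply, Matrix.add_apply, Matrix.mul_apply,
      Matrix.transpose_apply, h2, ← hchain (dg' _ _), Finset.mul_sum, Finset.sum_mul,
      ← Finset.sum_add_distrib, mul_add, add_mul]
    rw [Finset.sum_comm]
    refine Finset.sum_congr rfl fun j _ ↦ ?_
    simp only [Finset.sum_add_distrib]
    rw [add_right_comm]
    congr 1
    · congr 1
      · rw [Finset.sum_comm]
        exact Finset.sum_congr rfl fun i _ ↦ Finset.sum_congr rfl fun c _ ↦ by ring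
      · exact Finset.sum_congr rfl fun c _ ↦ Finset.sum_congr rfl fun i _ ↦ by ring
    · rw [Finset.sum_comm]
      exact Finset.sum_congr rfl fun i _ ↦ Finset.sum_congr rfl fun c _ ↦ by ring
  have hdX : DJ + jacobian F y * (Matrix.of fun a c ↦ pd c (localGrad g f a) y)
      = (Matrix.of fun i k ↦ pd k (localGrad g' f' i) (F y)) * jacobian F y := by
    ext i c
    have h1 := pd_congr_on hV (fun z hz ↦ hX hz i) hy c
    rw [pd_comp (dF hy) (dX' i), pd_sum_mul (fun a ↦ dJ i a) dX] at h1
    -- Symmetry of the second partials of F turns the derivative of J contracted with the gradient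
    -- into the derivative of J along the gradient, the matrix `DJ`.
    have h2 a : pd c (fun z ↦ jacobian F z i a) y = pd a (fun z ↦ jacobian F z i c) y :=
      pd_comm (sFi i) hV hy c a
    simp only [h2, Finset.sum_add_distrib] at h1
    simp only [hDJ, Matrix.add_apply, Matrix.of_apply, Matrix.mul_apply]
    rw [Finset.sum_congr rfl fun a _ ↦ mul_comm (localGrad g f a y) _, h1]
    exact Finset.sum_congr rfl fun a _ ↦ mul_comm _ _
  have t1 := trace_inv_mul_pullback (hg'.isUnit_det (hFV hy)) (hJ hy) (hgF y hy) hdG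
  have t2 := trace_conj_of_add_mul_eq (hJ hy) hdX
  rw [hg.localLaplacian_eq_divergence sf hy, hg'.localLaplacian_eq_divergence hf' (hFV hy)]
  simp only [Matrix.trace, Matrix.diag_apply, Matrix.mul_apply, hDG, hDG', Matrix.of_apply] at t1 t2
  linarith

end ChangeOfCoordinates

/-! ### The coordinate frame of a chart -/

section Frame

variable {n : ℕ} {M : Type*} [TopologicalSpace M] [ChartedSpace (Coord n) M]

theorem extChartAt_param {p : M} {z : Coord n} (hz : z ∈ (extChartAt (𝓡 n) p).target) :
    extChartAt (𝓡 n) p (param p z) = z :=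
  (extChartAt (𝓡 n) p).right_inv hz

theorem param_extChartAt {p x : M} (hx : x ∈ (extChartAt (𝓡 n) p).source) :
    param p (extChartAt (𝓡 n) p x) = x :=
  (extChartAt (𝓡 n) p).left_inv hx

/-- `component` as a linear form. -/
noncomputable def componentₗ (p : M) (k : Fin n) (x : M) : TangentSpace (𝓡 n) x →ₗ[ℝ] ℝ :=
  ((EuclideanSpace.proj (𝕜 := ℝ) k : Coord n →L[ℝ] ℝ).comp
    (mfderiv (𝓡 n) 𝓘(ℝ, Coord n) (extChartAt (𝓡 n) p) x)).toLinearMap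

theorem component_eq (p : M) (k : Fin n) {x : M} (v : TangentSpace (𝓡 n) x) :
    component p k v = componentₗ p k x v := rfl

theorem inner_grad [RiemannianBundle (fun x : M ↦ TangentSpace (𝓡 n) x)]
    (f : M → ℝ) (x : M) (v : TangentSpace (𝓡 n) x) :
    ⟪grad n f x, v⟫ = (mfderiv (𝓡 n) 𝓘(ℝ, ℝ) f x v : ℝ) :=
  inner_sharp x (mfderiv (𝓡 n) 𝓘(ℝ, ℝ) f x).toLinearMap v

variable [IsManifold (𝓡 n) ∞ M]

theorem mfderiv_extChartAt_mfderiv_param {p : M} {z : Coord n}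
    (hz : z ∈ (extChartAt (𝓡 n) p).target) (e : Coord n) :
    mfderiv (𝓡 n) 𝓘(ℝ, Coord n) (extChartAt (𝓡 n) p) (param p z)
      (mfderiv 𝓘(ℝ, Coord n) (𝓡 n) (param p) z e) = e := by
  have h := mfderiv_extChartAt_comp_mfderivWithin_extChartAt_symm (I := 𝓡 n) hz
  rw [ModelWithCorners.range_eq_univ, mfderivWithin_univ] at h
  exact DFunLike.congr_fun h e

theorem mfderiv_param_mfderiv_extChartAt {p : M} {z : Coord n}
    (hz : z ∈ (extChartAt (𝓡 n) p).target) (v : TangentSpace (𝓡 n) (param p z)) :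
    mfderiv 𝓘(ℝ, Coord n) (𝓡 n) (param p) z
      (mfderiv (𝓡 n) 𝓘(ℝ, Coord n) (extChartAt (𝓡 n) p) (param p z) v) = v := by
  have h := mfderivWithin_extChartAt_symm_comp_mfderiv_extChartAt (I := 𝓡 n) hz
  rw [ModelWithCorners.range_eq_univ, mfderivWithin_univ] at h
  exact DFunLike.congr_fun h v

theorem component_coordVec {p : M} {z : Coord n} (hz : z ∈ (extChartAt (𝓡 n) p).target)
    (k i : Fin n) : component p k (coordVec p i z) = if k = i then 1 else 0 := by
  have := congrArg (fun w : Coord n ↦ w k)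
    (mfderiv_extChartAt_mfderiv_param hz (EuclideanSpace.single i 1))
  refine this.trans ?_
  simp

theorem sum_component_smul_coordVec {p : M} {z : Coord n} (hz : z ∈ (extChartAt (𝓡 n) p).target)
    (v : TangentSpace (𝓡 n) (param p z)) : ∑ i, component p i v • coordVec p i z = v := by
  conv_rhs => rw [← mfderiv_param_mfderiv_extChartAt hz v]
  have h := (EuclideanSpace.basisFun (Fin n) ℝ).sum_repr
    (mfderiv (𝓡 n) 𝓘(ℝ, Coord n) (extChartAt (𝓡 n) p) (param p z) v : Coord n)
  have h2 := congrArg (mfderiv 𝓘(ℝ, Coord n) (𝓡 n) (param p) z) h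
  refine Eq.trans ?_ h2
  refine Eq.trans ?_ (map_sum (mfderiv 𝓘(ℝ, Coord n) (𝓡 n) (param p) z) _ _).symm
  refine Finset.sum_congr rfl fun i _ ↦ ?_
  refine Eq.trans ?_ (map_smul (mfderiv 𝓘(ℝ, Coord n) (𝓡 n) (param p) z) _ _).symm
  simp only [EuclideanSpace.basisFun_apply]
  rfl

theorem mdifferentiableAt_param {p : M} {z : Coord n} (hz : z ∈ (extChartAt (𝓡 n) p).target) :
    MDifferentiableAt 𝓘(ℝ, Coord n) (𝓡 n) (param p) z := by
  have h := mdifferentiableWithinAt_extChartAt_symm (I := 𝓡 n) hz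
  rwa [ModelWithCorners.range_eq_univ, mdifferentiableWithinAt_univ] at h

theorem mfderiv_coordVec {p : M} {z : Coord n} (hz : z ∈ (extChartAt (𝓡 n) p).target) {f : M → ℝ}
    (hf : MDifferentiableAt (𝓡 n) 𝓘(ℝ, ℝ) f (param p z)) (i : Fin n) :
    mfderiv (𝓡 n) 𝓘(ℝ, ℝ) f (param p z) (coordVec p i z) = pd i (fun y ↦ f (param p y)) z := by
  have h := mfderiv_comp z hf (mdifferentiableAt_param hz)
  rw [mfderiv_eq_fderiv] at h
  exact (DFunLike.congr_fun h (EuclideanSpace.single i 1)).symm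

theorem contMDiffOn_param (p : M) :
    ContMDiffOn 𝓘(ℝ, Coord n) (𝓡 n) ∞ (param p) (extChartAt (𝓡 n) p).target :=
  contMDiffOn_extChartAt_symm p

theorem contDiffOn_comp_param {f : M → ℝ} {p : M} {s : Set M}
    (hf : ContMDiffOn (𝓡 n) 𝓘(ℝ, ℝ) ∞ f s) :
    ContDiffOn ℝ ∞ (fun y ↦ f (param p y)) ((extChartAt (𝓡 n) p).target ∩ param p ⁻¹' s) :=
  contMDiffOn_iff_contDiffOn.1 <|
    hf.comp ((contMDiffOn_param p).mono Set.inter_subset_left) fun _ h ↦ h.2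

theorem isOpen_target_inter_preimage (p : M) {s : Set M} (hs : IsOpen s) :
    IsOpen ((extChartAt (𝓡 n) p).target ∩ param p ⁻¹' s) :=
  (contMDiffOn_param p).continuousOn.isOpen_inter_preimage (isOpen_extChartAt_target p) hs

theorem component_coordVec_eq_jacobian {p q : M} {z : Coord n}
    (hz : z ∈ (extChartAt (𝓡 n) p).target) (hq : param p z ∈ (extChartAt (𝓡 n) q).source)
    (a i : Fin n) :
    component q a (coordVec p i z) = jacobian (fun y ↦ extChartAt (𝓡 n) q (param p y)) z a i := by
  have hφ : MDifferentiableAt (𝓡 n) 𝓘(ℝ, Coord n) (extChartAt (𝓡 n) q) (param p z) :=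
    mdifferentiableAt_extChartAt (by rwa [extChartAt_source] at hq)
  have h := mfderiv_comp z hφ (mdifferentiableAt_param hz)
  have hd := (hφ.comp z (mdifferentiableAt_param hz)).differentiableAt
  rw [mfderiv_eq_fderiv] at h
  have h1 := congrArg (fun w : Coord n ↦ w a) (DFunLike.congr_fun h (EuclideanSpace.single i 1))
  refine h1.symm.trans ?_
  have := ((EuclideanSpace.proj (𝕜 := ℝ) a).hasFDerivAt.comp z hd.hasFDerivAt).fderiv
  simp only [jacobian, Matrix.of_apply, pd]
  rw [show (fun y ↦ extChartAt (𝓡 n) q (param p y) a) = (EuclideanSpace.proj (𝕜 := ℝ) a) ∘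
    (extChartAt (𝓡 n) q ∘ param p) from rfl, this]
  rfl

/-- The frame is the tangent map of `param p` applied to a constant field; smoothness of the metric
coefficients follows from this. -/
theorem contMDiffOn_coordVec (p : M) (i : Fin n) :
    ContMDiffOn 𝓘(ℝ, Coord n) ((𝓡 n).prod 𝓘(ℝ, Coord n)) ∞
      (fun z ↦ (⟨param p z, coordVec p i z⟩ : TangentBundle (𝓡 n) M))
      (extChartAt (𝓡 n) p).target := by
  have hO : IsOpen (extChartAt (𝓡 n) p).target := isOpen_extChartAt_target p
  have h := (contMDiffOn_param p).contMDiffOn_tangentMapWithin (m := ∞) (by simp)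
    hO.uniqueMDiffOn
  have hs : ContMDiff 𝓘(ℝ, Coord n) (𝓘(ℝ, Coord n).prod 𝓘(ℝ, Coord n)) ∞
      (fun z ↦ (⟨z, EuclideanSpace.single i 1⟩ : TangentBundle 𝓘(ℝ, Coord n) (Coord n))) := by
    exact contMDiff_vectorSpace_iff_contDiff.2 contDiff_const
  refine (h.comp hs.contMDiffOn (fun z hz ↦ hz)).congr fun z hz ↦ ?_
  simp only [Function.comp_def, tangentMapWithin]
  rw [mfderivWithin_of_isOpen hO hz]
  rfl

variable [RiemannianBundle (fun x : M ↦ TangentSpace (𝓡 n) x)]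

theorem inner_eq_sum_param {p : M} {z : Coord n} (hz : z ∈ (extChartAt (𝓡 n) p).target)
    (v w : TangentSpace (𝓡 n) (param p z)) :
    ⟪v, w⟫ = ∑ i, ∑ j, metricMatrix p z i j * component p i v * component p j w := by
  conv_lhs => rw [← sum_component_smul_coordVec hz v, ← sum_component_smul_coordVec hz w]
  simp only [sum_inner, inner_sum, inner_smul_left, inner_smul_right, metricMatrix,
    Matrix.of_apply, conj_trivial]
  simp only [Finset.mul_sum]
  rw [Finset.sum_comm]
  refine Finset.sum_congr rfl fun i _ ↦ Finset.sum_congr rfl fun j _ ↦ ?_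
  ring

theorem inner_eq_sum {p x : M} (hx : x ∈ (extChartAt (𝓡 n) p).source)
    (v w : TangentSpace (𝓡 n) x) :
    ⟪v, w⟫ = ∑ i, ∑ j, metricMatrix p (extChartAt (𝓡 n) p x) i j * component p i v
      * component p j w := by
  obtain ⟨z, hz, rfl⟩ : ∃ z ∈ (extChartAt (𝓡 n) p).target, param p z = x :=
    ⟨_, (extChartAt (𝓡 n) p).map_source hx, param_extChartAt hx⟩
  rw [inner_eq_sum_param hz, extChartAt_param hz]

variable [IsContMDiffRiemannianBundle (𝓡 n) ∞ (EuclideanSpace ℝ (Fin n))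
      (fun x : M ↦ TangentSpace (𝓡 n) x)]

theorem isLocalMetric_metricMatrix (p : M) :
    IsLocalMetric (metricMatrix p) (extChartAt (𝓡 n) p).target where
  isOpen := isOpen_extChartAt_target p
  smooth i j := contMDiffOn_iff_contDiffOn.1 <|
    (contMDiffOn_coordVec p i).inner_bundle (contMDiffOn_coordVec p j)
  symm {z} _ i j := real_inner_comm (coordVec p j z) (coordVec p i z)
  isUnit_det {z} hz := by
    rw [isUnit_iff_ne_zero]
    intro h0
    -- A kernel vector c of the Gram matrix would be the coordinates of a tangent vector of norm
    -- zero.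
    obtain ⟨c, hc, h⟩ := Matrix.exists_mulVec_eq_zero_iff.2 h0
    apply hc
    have hcomp : ∀ k, component p k (∑ i, c i • coordVec p i z) = c k := by
      intro k
      rw [component_eq, map_sum]
      simp only [map_smul, ← component_eq, component_coordVec hz]
      simp
    have h1 : ⟪∑ i, c i • coordVec p i z, ∑ i, c i • coordVec p i z⟫ = 0 := by
      rw [inner_eq_sum_param hz]
      simp only [hcomp]
      refine Finset.sum_eq_zero fun i _ ↦ ?_
      have h2 := congrFun h i
      simp only [Matrix.mulVec, dotProduct, Pi.zero_apply] at h2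
      calc _ = c i * ∑ j, metricMatrix p z i j * c j := by
            rw [Finset.mul_sum]; exact Finset.sum_congr rfl fun j _ ↦ by ring
        _ = 0 := by rw [h2, mul_zero]
    have h2 := inner_self_eq_zero.1 h1
    ext k
    rw [← hcomp k, h2, component_eq, map_zero]
    rfl

theorem component_grad {p : M} {z : Coord n} (hz : z ∈ (extChartAt (𝓡 n) p).target) {f : M → ℝ}
    (hf : MDifferentiableAt (𝓡 n) 𝓘(ℝ, ℝ) f (param p z)) (k : Fin n) :
    component p k (grad n f (param p z))
      = localGrad (metricMatrix p) (fun y ↦ f (param p y)) k z := by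
  have h : ∀ j, ∑ l, metricMatrix p z j l * component p l (grad n f (param p z))
      = pd j (fun y ↦ f (param p y)) z := by
    intro j
    rw [← mfderiv_coordVec hz hf, ← inner_grad, real_inner_comm, inner_eq_sum_param hz]
    simp only [component_coordVec hz]
    simp
  simp only [localGrad, ← h]
  exact ((isLocalMetric_metricMatrix p).sum_inv_mul_sum_mul hz k _).symm

theorem inner_grad_grad {p : M} {z : Coord n} (hz : z ∈ (extChartAt (𝓡 n) p).target) {f h : M → ℝ}
    (hf : MDifferentiableAt (𝓡 n) 𝓘(ℝ, ℝ) f (param p z))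
    (hh : MDifferentiableAt (𝓡 n) 𝓘(ℝ, ℝ) h (param p z)) :
    ⟪grad n f (param p z), grad n h (param p z)⟫
      = ∑ i, localGrad (metricMatrix p) (fun y ↦ f (param p y)) i z
        * pd i (fun y ↦ h (param p y)) z := by
  rw [inner_eq_sum_param hz]
  refine Finset.sum_congr rfl fun i _ ↦ ?_
  rw [← (isLocalMetric_metricMatrix p).sum_mul_grad hz i, Finset.mul_sum]
  refine Finset.sum_congr rfl fun j _ ↦ ?_
  rw [component_grad hz hf, component_grad hz hh]
  ring

/-- The left side is computed in the preferred chart of the point itself, the right side in the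
chart at p. The transition map pulls one metric matrix back to the other, so `localLaplacian_comp`
applies. -/
theorem laplacian_param {p : M} {z : Coord n} (hz : z ∈ (extChartAt (𝓡 n) p).target) {f : M → ℝ}
    (hf : ContMDiff (𝓡 n) 𝓘(ℝ, ℝ) ∞ f) :
    laplacian n f (param p z) = localLaplacian (metricMatrix p) (fun y ↦ f (param p y)) z := by
  obtain ⟨q, hq⟩ : ∃ q, q = param p z := ⟨_, rfl⟩
  rw [← hq]
  set V := (extChartAt (𝓡 n) p).target ∩ param p ⁻¹' (extChartAt (𝓡 n) q).source with hV
  have hVo : IsOpen V := isOpen_target_inter_preimage p (isOpen_extChartAt_source q)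
  have hzV : z ∈ V := ⟨hz, by rw [Set.mem_preimage, ← hq]; exact mem_extChartAt_source q⟩
  have hF : ContDiffOn ℝ ∞ (fun y ↦ extChartAt (𝓡 n) q (param p y)) V := by
    refine contMDiffOn_iff_contDiffOn.1 <| (contMDiffOn_extChartAt (x := q)).comp
      ((contMDiffOn_param p).mono Set.inter_subset_left) fun y hy ↦ ?_
    rw [← extChartAt_source (𝓡 n)]
    exact hy.2
  have h := ((isLocalMetric_metricMatrix p).mono hVo Set.inter_subset_left).localLaplacian_comp
    (isLocalMetric_metricMatrix q) hF
    (fun y hy ↦ (extChartAt (𝓡 n) q).map_source hy.2)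
    (fun y hy ↦ ?_) (f := fun y ↦ f (param p y)) (f' := fun y ↦ f (param q y))
    ((contDiffOn_comp_param (p := q) hf.contMDiffOn (s := Set.univ)).mono (by simp))
    (fun y hy ↦ by simp only [param_extChartAt hy.2]) hzV
  · rw [h, ← hq]
    rfl
  · ext a b
    change ⟪coordVec p a y, coordVec p b y⟫ = _
    rw [inner_eq_sum hy.2]
    simp only [component_coordVec_eq_jacobian hy.1 hy.2, Matrix.mul_apply, Matrix.transpose_apply,
      Finset.sum_mul]
    rw [Finset.sum_comm]
    exact Finset.sum_congr rfl fun i _ ↦ Finset.sum_congr rfl fun j _ ↦ by ring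

end Frame

/-! ### Traces over the orthogonal complement of a line -/

section OrthogonalComplement

variable {E : Type*} [NormedAddCommGroup E] [InnerProductSpace ℝ E]
  {ι : Type*} [Fintype ι] {G N : E} (b : OrthonormalBasis ι ℝ (Submodule.span ℝ {G})ᗮ)

/-- Parseval in the complement for the projections v - ⟨v, N⟩N and w - ⟨w, N⟩N. -/
theorem sum_inner_mul_inner_orthogonal (hG : G ≠ 0) (hN : N = ‖G‖⁻¹ • G) (v w : E) :
    ∑ i, ⟪v, (b i : E)⟫ * ⟪(b i : E), w⟫ = ⟪v, w⟫ - ⟪v, N⟫ * ⟪N, w⟫ := by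
  have hG' : ‖G‖ ≠ 0 := norm_ne_zero_iff.2 hG
  have hNN : ⟪N, N⟫ = 1 := by
    rw [hN, inner_smul_left, inner_smul_right, real_inner_self_eq_norm_sq]
    simp only [conj_trivial]; field_simp
  have hbN i : ⟪(b i : E), N⟫ = 0 := by
    rw [hN, inner_smul_right, Submodule.mem_orthogonal_singleton_iff_inner_left.1 (b i).2, mul_zero]
  have hmem (v : E) : v - ⟪v, N⟫ • N ∈ (Submodule.span ℝ {G})ᗮ := by
    rw [Submodule.mem_orthogonal_singleton_iff_inner_left, inner_sub_left, inner_smul_left, hN,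
      inner_smul_right, inner_smul_left, real_inner_self_eq_norm_sq]
    simp only [conj_trivial]; field_simp; ring
  have h := b.sum_inner_mul_inner ⟨_, hmem v⟩ ⟨_, hmem w⟩
  simp only [Submodule.coe_inner, inner_sub_left, inner_sub_right, inner_smul_left,
    inner_smul_right, hbN, fun i ↦ (real_inner_comm (b i : E) N).trans (hbN i), hNN, conj_trivial,
    mul_zero, sub_zero, mul_one, sub_self] at h
  exact h

variable [FiniteDimensional ℝ E]

theorem sum_inner_map_orthogonal (hG : G ≠ 0) (hN : N = ‖G‖⁻¹ • G) (C : E →ₗ[ℝ] E) :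
    ∑ i, ⟪C (b i), (b i : E)⟫ = LinearMap.trace ℝ E C - ⟪C N, N⟫ := by
  set e := stdOrthonormalBasis ℝ E
  rw [LinearMap.trace_eq_sum_inner C e, ← e.sum_inner_mul_inner]
  have h1 i : ⟪C (b i), (b i : E)⟫
      = ∑ k, ⟪LinearMap.adjoint C (e k), (b i : E)⟫ * ⟪(b i : E), e k⟫ := by
    rw [← e.sum_inner_mul_inner]
    refine Finset.sum_congr rfl fun k _ ↦ ?_
    rw [LinearMap.adjoint_inner_left, real_inner_comm (e k), real_inner_comm (e k)]
  simp only [h1]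
  rw [Finset.sum_comm, ← Finset.sum_sub_distrib]
  refine Finset.sum_congr rfl fun k _ ↦ ?_
  rw [sum_inner_mul_inner_orthogonal b hG hN, LinearMap.adjoint_inner_left,
    LinearMap.adjoint_inner_left, real_inner_comm (e k) (C N), real_inner_comm (e k) N]

/-- The inner sum is |Cbᵢ|² - ⟨CN, bᵢ⟩² by symmetry of C. Summing over i gives tr C² - |CN|² from
the first term and |CN|² - ⟨CN, N⟩² from the second. -/
theorem sum_sq_inner_map_orthogonal (hG : G ≠ 0) (hN : N = ‖G‖⁻¹ • G) {C : E →ₗ[ℝ] E}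
    (hC : C.IsSymmetric) :
    ∑ i, ∑ j, ⟪C (b i), (b j : E)⟫ ^ 2
      = LinearMap.trace ℝ E (C ∘ₗ C) - 2 * ‖C N‖ ^ 2 + ⟪C N, N⟫ ^ 2 := by
  have h1 i : ∑ j, ⟪C (b i), (b j : E)⟫ ^ 2
      = ⟪(C ∘ₗ C) (b i), (b i : E)⟫ - ⟪C N, (b i : E)⟫ * ⟪(b i : E), C N⟫ := by
    have := sum_inner_mul_inner_orthogonal b hG hN (C (b i)) (C (b i))
    rw [real_inner_comm (C (b i)) N] at this
    rw [LinearMap.comp_apply, hC (C (b i)), hC N, real_inner_comm (C (b i)) N, ← hC (b i) N,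
      ← this]
    refine Finset.sum_congr rfl fun j _ ↦ ?_
    rw [real_inner_comm (C (b i))]; ring
  simp only [h1, Finset.sum_sub_distrib]
  rw [sum_inner_map_orthogonal b hG hN, sum_inner_mul_inner_orthogonal b hG hN,
    LinearMap.comp_apply, hC (C N), real_inner_self_eq_norm_sq, real_inner_comm (C N) N]
  ring

/-- Removing the trace part lowers the squared norm by trace²/dim. It is used with C the Hessian of
u and r = |∇u|⁻¹, so that r⟨Cv, w⟩ is the second fundamental form. -/
theorem sum_sq_tracefree_orthogonal (hG : G ≠ 0) (hN : N = ‖G‖⁻¹ • G) {C : E →ₗ[ℝ] E}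
    (hC : C.IsSymmetric) (hn : (Module.finrank ℝ E : ℝ) - 1 ≠ 0) (r : ℝ) :
    ∑ i, ∑ j, (r * ⟪C (b i), (b j : E)⟫
        - (∑ k, r * ⟪C (b k), (b k : E)⟫) / (Module.finrank ℝ E - 1) * ⟪b i, b j⟫) ^ 2
      = r ^ 2 * (LinearMap.trace ℝ E (C ∘ₗ C) - 2 * ‖C N‖ ^ 2 + ⟪C N, N⟫ ^ 2)
        - (r * (LinearMap.trace ℝ E C - ⟪C N, N⟫)) ^ 2 / (Module.finrank ℝ E - 1) := by
  classical
  have hNN : ⟪N, N⟫ = 1 := by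
    have hG' : ‖G‖ ≠ 0 := norm_ne_zero_iff.2 hG
    rw [hN, inner_smul_left, inner_smul_right, real_inner_self_eq_norm_sq]
    simp only [conj_trivial]; field_simp
  -- The trace formula for the identity map counts the basis of the complement.
  have hcard : ∑ _i : ι, (1 : ℝ) = Module.finrank ℝ E - 1 := by
    have h := sum_inner_map_orthogonal b hG hN LinearMap.id
    simp only [LinearMap.id_apply, hNN, LinearMap.trace_id] at h
    rw [← h]
    refine Finset.sum_congr rfl fun i _ ↦ ?_
    rw [← Submodule.coe_inner, real_inner_self_eq_norm_sq, b.norm_eq_one]; norm_num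
  rw [← sum_sq_inner_map_orthogonal b hG hN hC, ← sum_inner_map_orthogonal b hG hN C]
  set t := (∑ k, r * ⟪C (b k), (b k : E)⟫) / ((Module.finrank ℝ E : ℝ) - 1) with ht
  have h2 i j : (r * ⟪C (b i), (b j : E)⟫ - t * ⟪b i, b j⟫) ^ 2
      = r ^ 2 * ⟪C (b i), (b j : E)⟫ ^ 2
        + (if i = j then t ^ 2 * 1 - 2 * t * (r * ⟪C (b i), (b j : E)⟫) else 0) := by
    rw [orthonormal_iff_ite.1 b.orthonormal i j]
    split_ifs <;> ring
  simp only [h2, Finset.sum_add_distrib, Finset.sum_ite_eq, Finset.mem_univ, if_true,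
    Finset.sum_sub_distrib, ← Finset.mul_sum, hcard]
  rw [ht, ← Finset.mul_sum]
  field_simp
  ring

end OrthogonalComplement

/-! ### The Hessian of u as a symmetric endomorphism of the tangent space. -/

section HessianEndomorphism

variable {n : ℕ} {M : Type*} [TopologicalSpace M] [ChartedSpace (Coord n) M]

theorem norm_unitNormal [RiemannianBundle (fun x : M ↦ TangentSpace (𝓡 n) x)] {u : M → ℝ} {x : M}
    (hx : grad n u x ≠ 0) : ‖unitNormal n u x‖ = 1 := by
  rw [unitNormal, norm_smul, norm_inv, norm_norm, inv_mul_cancel₀ (norm_ne_zero_iff.2 hx)]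

variable [IsManifold (𝓡 n) ∞ M]

theorem exists_basis_repr_eq_component (x : M) :
    ∃ b : Module.Basis (Fin n) ℝ (TangentSpace (𝓡 n) x), ∀ v k, b.repr v k = component x k v := by
  obtain ⟨e, he⟩ := isInvertible_mfderiv_extChartAt (I := 𝓡 n) (mem_extChartAt_source (I := 𝓡 n) x)
  refine ⟨Module.Basis.ofEquivFun
    (e.toLinearEquiv.trans (WithLp.linearEquiv 2 ℝ (Fin n → ℝ))), fun v k ↦ ?_⟩
  have : component x k v = (show Coord n from e v) k := by
    rw [← ContinuousLinearEquiv.coe_coe, he]; rfl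
  rw [this]
  rfl

/-- The frame of the preferred chart at `x`, as a basis of `T_x M`. -/
noncomputable def coordBasis (x : M) : Module.Basis (Fin n) ℝ (TangentSpace (𝓡 n) x) :=
  (exists_basis_repr_eq_component x).choose

theorem coordBasis_repr (x : M) (v : TangentSpace (𝓡 n) x) (k : Fin n) :
    (coordBasis x).repr v k = component x k v :=
  (exists_basis_repr_eq_component x).choose_spec v k

theorem contDiffOn_comp_param_target {u : M → ℝ}
    (hu : ContMDiff (𝓡 n) 𝓘(ℝ, ℝ) ∞ u) (x : M) :
    ContDiffOn ℝ ∞ (fun y ↦ u (param x y)) (extChartAt (𝓡 n) x).target :=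
  (contDiffOn_comp_param (p := x) hu.contMDiffOn (s := Set.univ)).mono (by simp)

variable [RiemannianBundle (fun x : M ↦ TangentSpace (𝓡 n) x)]

variable (n) in
/-- The components of `∇∇u` in the chart at `x`. -/
noncomputable def hessMatrix (u : M → ℝ) (x : M) : Matrix (Fin n) (Fin n) ℝ :=
  Matrix.of fun i k ↦ localCovDeriv (localChristoffel (metricMatrix x))
    (localGrad (metricMatrix x) (fun y ↦ u (param x y))) i k (extChartAt (𝓡 n) x x)

variable (n) in
/-- The Hessian as an endomorphism `v ↦ ∇_v ∇u` of the tangent space. -/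
noncomputable def hessEnd (u : M → ℝ) (x : M) :
    TangentSpace (𝓡 n) x →ₗ[ℝ] TangentSpace (𝓡 n) x :=
  Matrix.toLin (coordBasis x) (coordBasis x) (hessMatrix n u x)

theorem component_hessEnd (u : M → ℝ) (x : M) (v : TangentSpace (𝓡 n) x) (k : Fin n) :
    component x k (hessEnd n u x v) = ∑ i, hessMatrix n u x k i * component x i v := by
  rw [← coordBasis_repr, hessEnd, Matrix.repr_toLin]
  simp only [Matrix.mulVec, dotProduct, coordBasis_repr]

theorem trace_hessEnd (u : M → ℝ) (x : M) :
    LinearMap.trace ℝ _ (hessEnd n u x) = ∑ i, hessMatrix n u x i i := by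
  rw [LinearMap.trace_eq_matrix_trace ℝ (coordBasis x), hessEnd, LinearMap.toMatrix_toLin]
  rfl

theorem trace_hessEnd_comp (u : M → ℝ) (x : M) :
    LinearMap.trace ℝ _ (hessEnd n u x ∘ₗ hessEnd n u x)
      = ∑ i, ∑ k, hessMatrix n u x i k * hessMatrix n u x k i := by
  rw [LinearMap.trace_eq_matrix_trace ℝ (coordBasis x), hessEnd, ← Matrix.toLin_mul,
    LinearMap.toMatrix_toLin]
  rfl

variable [IsContMDiffRiemannianBundle (𝓡 n) ∞ (EuclideanSpace ℝ (Fin n))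
      (fun x : M ↦ TangentSpace (𝓡 n) x)]

theorem component_grad_self {f : M → ℝ} {x : M} (hf : MDifferentiableAt (𝓡 n) 𝓘(ℝ, ℝ) f x)
    (k : Fin n) : component x k (grad n f x)
      = localGrad (metricMatrix x) (fun y ↦ f (param x y)) k (extChartAt (𝓡 n) x x) := by
  -- Chart centre and point are kept apart: writing x as `param x z` directly would also rewrite the
  -- centre of the chart.
  have key {p q : M} (hq : q ∈ (extChartAt (𝓡 n) p).source)
      (hf : MDifferentiableAt (𝓡 n) 𝓘(ℝ, ℝ) f q) : component p k (grad n f q)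
      = localGrad (metricMatrix p) (fun y ↦ f (param p y)) k (extChartAt (𝓡 n) p q) := by
    obtain ⟨z, hz, rfl⟩ : ∃ z ∈ (extChartAt (𝓡 n) p).target, param p z = q :=
      ⟨_, (extChartAt (𝓡 n) p).map_source hq, param_extChartAt hq⟩
    rw [component_grad hz hf, extChartAt_param hz]
  exact key (mem_extChartAt_source x) hf

theorem inner_grad_grad_self {f h : M → ℝ} {x : M} (hf : MDifferentiableAt (𝓡 n) 𝓘(ℝ, ℝ) f x)
    (hh : MDifferentiableAt (𝓡 n) 𝓘(ℝ, ℝ) h x) :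
    ⟪grad n f x, grad n h x⟫
      = ∑ i, localGrad (metricMatrix x) (fun y ↦ f (param x y)) i (extChartAt (𝓡 n) x x)
        * pd i (fun y ↦ h (param x y)) (extChartAt (𝓡 n) x x) := by
  rw [inner_eq_sum (mem_extChartAt_source x)]
  refine Finset.sum_congr rfl fun i _ ↦ ?_
  rw [← (isLocalMetric_metricMatrix x).sum_mul_grad (mem_extChartAt_target x) i, Finset.mul_sum]
  refine Finset.sum_congr rfl fun j _ ↦ ?_
  rw [component_grad_self hf, component_grad_self hh]
  ring

variable {u : M → ℝ}

theorem inner_hessEnd (hu : ContMDiff (𝓡 n) 𝓘(ℝ, ℝ) ∞ u) (x : M) (v w : TangentSpace (𝓡 n) x) :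
    ⟪hessEnd n u x v, w⟫ = hess u x v w := by
  have hz := mem_extChartAt_target (I := 𝓡 n) x
  -- `hessCoord x u` is by definition `localHess` of u read in the chart at x.
  have hh i j : hessCoord x u i j (extChartAt (𝓡 n) x x)
      = ∑ l, metricMatrix x (extChartAt (𝓡 n) x x) j l * hessMatrix n u x l i :=
    (isLocalMetric_metricMatrix x).localHess_eq_sum (contDiffOn_comp_param_target hu x) hz i j
  rw [inner_eq_sum (mem_extChartAt_source x)]
  simp only [hess, hh, component_hessEnd, Finset.mul_sum, Finset.sum_mul]
  rw [sum_comm_three]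
  refine Finset.sum_congr rfl fun i _ ↦ Finset.sum_congr rfl fun j _ ↦
    Finset.sum_congr rfl fun l _ ↦ ?_
  rw [(isLocalMetric_metricMatrix x).symm hz l j]
  ring

theorem hessEnd_isSymmetric (hu : ContMDiff (𝓡 n) 𝓘(ℝ, ℝ) ∞ u) (x : M) :
    (hessEnd n u x).IsSymmetric := by
  intro v w
  rw [real_inner_comm _ v, inner_hessEnd hu, inner_hessEnd hu, hess, hess, Finset.sum_comm]
  refine Finset.sum_congr rfl fun i _ ↦ Finset.sum_congr rfl fun j _ ↦ ?_
  have : hessCoord x u j i (extChartAt (𝓡 n) x x) = hessCoord x u i j (extChartAt (𝓡 n) x x) :=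
    (isLocalMetric_metricMatrix x).localHess_symm (contDiffOn_comp_param_target hu x)
      (mem_extChartAt_target x) j i
  rw [this]; ring

theorem inner_grad_eq_sum (hu : ContMDiff (𝓡 n) 𝓘(ℝ, ℝ) ∞ u) (x : M)
    (v : TangentSpace (𝓡 n) x) :
    ⟪grad n u x, v⟫
      = ∑ i, pd i (fun y ↦ u (param x y)) (extChartAt (𝓡 n) x x) * component x i v := by
  rw [real_inner_comm, inner_eq_sum (mem_extChartAt_source x)]
  refine Finset.sum_congr rfl fun i _ ↦ ?_
  rw [← (isLocalMetric_metricMatrix x).sum_mul_grad (mem_extChartAt_target x) i, Finset.sum_mul]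
  refine Finset.sum_congr rfl fun j _ ↦ ?_
  rw [component_grad_self (hu.mdifferentiable (by simp) x)]
  ring

theorem hess_sq (hu : ContMDiff (𝓡 n) 𝓘(ℝ, ℝ) ∞ u) (x : M) (v w : TangentSpace (𝓡 n) x) :
    hess (fun y ↦ u y ^ 2) x v w
      = 2 * u x * ⟪hessEnd n u x v, w⟫ + 2 * ⟪grad n u x, v⟫ * ⟪grad n u x, w⟫ := by
  have hz := mem_extChartAt_target (I := 𝓡 n) x
  have hs := contDiffOn_comp_param_target hu x
  have h1 i j : hessCoord x (fun y ↦ u y ^ 2) i j (extChartAt (𝓡 n) x x)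
      = 2 * u x * hessCoord x u i j (extChartAt (𝓡 n) x x)
        + 2 * pd i (fun y ↦ u (param x y)) (extChartAt (𝓡 n) x x)
          * pd j (fun y ↦ u (param x y)) (extChartAt (𝓡 n) x x) := by
    have h := (isLocalMetric_metricMatrix x).localHess_mul hs hs hz i j
    simp only [← pow_two, param_extChartAt (mem_extChartAt_source x)] at h
    refine Eq.trans h ?_
    change _ = 2 * u x * localHess (metricMatrix x) _ i j _ + _
    ring
  rw [inner_hessEnd hu, inner_grad_eq_sum hu, inner_grad_eq_sum hu, hess, hess,
    mul_assoc 2 (∑ i, _), Finset.sum_mul_sum, Finset.mul_sum, Finset.mul_sum,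
    ← Finset.sum_add_distrib]
  refine Finset.sum_congr rfl fun i _ ↦ ?_
  rw [Finset.mul_sum, Finset.mul_sum, ← Finset.sum_add_distrib]
  refine Finset.sum_congr rfl fun j _ ↦ ?_
  rw [h1]; ring

/-! ### The tensor `B` and the second fundamental form -/

/-- From Hess u² = 2u Hess u + 2 du ⊗ du; applied to 𝐧, the last term is 2|∇u|²⟨𝐧, ·⟩, which the
definition of B subtracts. -/
theorem vecBn_eq (hu : ContMDiff (𝓡 n) 𝓘(ℝ, ℝ) ∞ u) {x : M} (hx : grad n u x ≠ 0) :
    vecBn n u x = (2 * u x) • hessEnd n u x (unitNormal n u x) := by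
  have h0 : ‖grad n u x‖ ≠ 0 := norm_ne_zero_iff.2 hx
  have h : tensorB n u x (unitNormal n u x)
      = (innerₛₗ ℝ ((2 * u x) • hessEnd n u x (unitNormal n u x)) :
        TangentSpace (𝓡 n) x →ₗ[ℝ] ℝ) := by
    funext v
    rw [tensorB, hess_sq hu, innerₛₗ_apply_apply, inner_smul_left]
    -- Only the occurrences of 𝐧 outside the Hessian are unfolded.
    nth_rw 3 [unitNormal]
    nth_rw 2 [unitNormal]
    simp only [inner_smul_left, inner_smul_right, real_inner_self_eq_norm_sq, conj_trivial]
    field_simp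
    ring
  rw [vecBn, h]
  refine ext_inner_right ℝ fun v ↦ ?_
  rw [inner_sharp, innerₛₗ_apply_apply]

theorem sq_norm_vecBn (hu : ContMDiff (𝓡 n) 𝓘(ℝ, ℝ) ∞ u) {x : M} (hx : grad n u x ≠ 0) :
    ‖vecBn n u x‖ ^ 2 = 4 * u x ^ 2 * ‖hessEnd n u x (unitNormal n u x)‖ ^ 2 := by
  rw [vecBn_eq hu hx, norm_smul, mul_pow, Real.norm_eq_abs, sq_abs]
  ring

theorem sq_norm_vecBnTan (hu : ContMDiff (𝓡 n) 𝓘(ℝ, ℝ) ∞ u) {x : M} (hx : grad n u x ≠ 0) :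
    ‖vecBnTan n u x‖ ^ 2 = 4 * u x ^ 2 * (‖hessEnd n u x (unitNormal n u x)‖ ^ 2
      - ⟪hessEnd n u x (unitNormal n u x), unitNormal n u x⟫ ^ 2) := by
  rw [vecBnTan, norm_sub_sq_real, sq_norm_vecBn hu hx, norm_smul, norm_unitNormal hx,
    inner_smul_right, vecBn_eq hu hx, inner_smul_left, Real.norm_eq_abs, mul_one, sq_abs]
  simp only [conj_trivial]
  ring

variable (n) in
/-- The function `|∇u|²` in the chart at `x`. -/
noncomputable def localSqNormGrad (u : M → ℝ) (x : M) (z : Coord n) : ℝ :=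
  ∑ i, localGrad (metricMatrix x) (fun y ↦ u (param x y)) i z * pd i (fun y ↦ u (param x y)) z

theorem norm_grad_param (hu : ContMDiff (𝓡 n) 𝓘(ℝ, ℝ) ∞ u) {x : M} {z : Coord n}
    (hz : z ∈ (extChartAt (𝓡 n) x).target) :
    ‖grad n u (param x z)‖ = √(localSqNormGrad n u x z) := by
  have hd := hu.mdifferentiable (by simp) (param x z)
  rw [localSqNormGrad, ← inner_grad_grad hz hd hd, real_inner_self_eq_norm_sq,
    Real.sqrt_sq (norm_nonneg _)]

theorem norm_grad_self (hu : ContMDiff (𝓡 n) 𝓘(ℝ, ℝ) ∞ u) (x : M) :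
    ‖grad n u x‖ ^ 2 = localSqNormGrad n u x (extChartAt (𝓡 n) x x) := by
  have hd := hu.mdifferentiable (by simp) x
  rw [localSqNormGrad, ← inner_grad_grad_self hd hd, real_inner_self_eq_norm_sq]

theorem contDiffOn_localSqNormGrad (hu : ContMDiff (𝓡 n) 𝓘(ℝ, ℝ) ∞ u) (x : M) :
    ContDiffOn ℝ ∞ (localSqNormGrad n u x) (extChartAt (𝓡 n) x).target :=
  (isLocalMetric_metricMatrix x).smooth_sq_norm_grad (contDiffOn_comp_param_target hu x)

theorem contDiffAt_localSqNormGrad (hu : ContMDiff (𝓡 n) 𝓘(ℝ, ℝ) ∞ u) (x : M) :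
    ContDiffAt ℝ ∞ (localSqNormGrad n u x) (extChartAt (𝓡 n) x x) :=
  (contDiffOn_localSqNormGrad hu x).contDiffAt (extChartAt_target_mem_nhds x)

theorem contMDiffAt_norm_grad (hu : ContMDiff (𝓡 n) 𝓘(ℝ, ℝ) ∞ u) {x : M} (hx : grad n u x ≠ 0) :
    ContMDiffAt (𝓡 n) 𝓘(ℝ, ℝ) ∞ (fun y ↦ ‖grad n u y‖) x := by
  have h0 : localSqNormGrad n u x (extChartAt (𝓡 n) x x) ≠ 0 := by
    rw [← norm_grad_self hu]; exact pow_ne_zero _ (norm_ne_zero_iff.2 hx)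
  have h := ((contDiffAt_localSqNormGrad hu x).sqrt h0).contMDiffAt.comp x
    (contMDiffAt_extChartAt (I := 𝓡 n) (n := ∞))
  refine h.congr_of_eventuallyEq ?_
  filter_upwards [extChartAt_source_mem_nhds (I := 𝓡 n) x] with y hy
  have := norm_grad_param hu ((extChartAt (𝓡 n) x).map_source hy)
  rwa [param_extChartAt hy] at this

/-- By the Leibniz rule ∇_v 𝐧 = v(|∇u|⁻¹)∇u + |∇u|⁻¹∇_v∇u, and w is orthogonal to ∇u. -/
theorem innerCovDeriv_unitNormal (hu : ContMDiff (𝓡 n) 𝓘(ℝ, ℝ) ∞ u) {x : M} (hx : grad n u x ≠ 0)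
    (v w : TangentSpace (𝓡 n) x) (hw : ⟪grad n u x, w⟫ = 0) :
    innerCovDeriv (unitNormal n u) x v w = ‖grad n u x‖⁻¹ * ⟪hessEnd n u x v, w⟫ := by
  have hz := mem_extChartAt_target (I := 𝓡 n) x
  have hg := isLocalMetric_metricMatrix (n := n) x
  have h0 : localSqNormGrad n u x (extChartAt (𝓡 n) x x) ≠ 0 := by
    rw [← norm_grad_self hu]; exact pow_ne_zero _ (norm_ne_zero_iff.2 hx)
  have hnorm : ‖grad n u x‖ = √(localSqNormGrad n u x (extChartAt (𝓡 n) x x)) := by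
    rw [← norm_grad_self hu, Real.sqrt_sq (norm_nonneg _)]
  have dr : DifferentiableAt ℝ (fun z ↦ (√(localSqNormGrad n u x z))⁻¹) (extChartAt (𝓡 n) x x) := by
    refine DifferentiableAt.fun_inv
      (((contDiffAt_localSqNormGrad hu x).sqrt h0).differentiableAt (by simp)) ?_
    rw [← hnorm]; exact norm_ne_zero_iff.2 hx
  have dX k := (hg.smooth_grad (contDiffOn_comp_param_target hu x) k).differentiableAt_of_isOpen
    hg.isOpen hz
  have h1 i k : pd i (fun y ↦ component x k (unitNormal n u (param x y))) (extChartAt (𝓡 n) x x)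
      = pd i (fun z ↦ (√(localSqNormGrad n u x z))⁻¹) (extChartAt (𝓡 n) x x)
          * component x k (grad n u x)
        + ‖grad n u x‖⁻¹ * pd i (localGrad (metricMatrix x) (fun y ↦ u (param x y)) k)
          (extChartAt (𝓡 n) x x) := by
    rw [component_grad_self (hu.mdifferentiable (by simp) x), hnorm, ← pd_mul dr (dX k)]
    refine pd_congr_on hg.isOpen (fun y hy ↦ ?_) hz i
    rw [unitNormal, component_eq, map_smul, ← component_eq,
      component_grad hy (hu.mdifferentiable (by simp) _), norm_grad_param hu hy, smul_eq_mul]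
  have h2 k : covDerivComponent (unitNormal n u) x v k
      = component x k ((∑ i, component x i v *
          pd i (fun z ↦ (√(localSqNormGrad n u x z))⁻¹) (extChartAt (𝓡 n) x x)) • grad n u x
        + ‖grad n u x‖⁻¹ • hessEnd n u x v) := by
    have h3 j : component x j (unitNormal n u x) = ‖grad n u x‖⁻¹
        * localGrad (metricMatrix x) (fun y ↦ u (param x y)) j (extChartAt (𝓡 n) x x) := by
      rw [unitNormal, component_eq, map_smul, ← component_eq,
        component_grad_self (hu.mdifferentiable (by simp) x), smul_eq_mul]
    rw [component_eq, map_add, map_smul, map_smul, ← component_eq, ← component_eq,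
      component_hessEnd, covDerivComponent]
    simp only [h1, h3, hessMatrix, Matrix.of_apply, localCovDeriv, smul_eq_mul, mul_add, add_mul,
      Finset.sum_add_distrib, Finset.mul_sum, Finset.sum_mul]
    rw [add_assoc]
    congr 1
    · exact Finset.sum_congr rfl fun i _ ↦ by ring
    · congr 1
      · exact Finset.sum_congr rfl fun i _ ↦ by ring
      · exact Finset.sum_congr rfl fun i _ ↦ Finset.sum_congr rfl fun j _ ↦ by
          change localChristoffel (metricMatrix x) k i j _ * _ * _ = _
          ring
  rw [innerCovDeriv]
  simp only [h2]
  rw [← inner_eq_sum (mem_extChartAt_source x), inner_add_left, inner_smul_left, inner_smul_left,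
    hw]
  simp

theorem normSqII₀_eq (hn : 2 ≤ n) (hu : ContMDiff (𝓡 n) 𝓘(ℝ, ℝ) ∞ u) {x : M}
    (hx : grad n u x ≠ 0) :
    normSqII₀ n u x = ‖grad n u x‖⁻¹ ^ 2 * (LinearMap.trace ℝ _ (hessEnd n u x ∘ₗ hessEnd n u x)
        - 2 * ‖hessEnd n u x (unitNormal n u x)‖ ^ 2
        + ⟪hessEnd n u x (unitNormal n u x), unitNormal n u x⟫ ^ 2)
      - (‖grad n u x‖⁻¹ * (LinearMap.trace ℝ _ (hessEnd n u x)
        - ⟪hessEnd n u x (unitNormal n u x), unitNormal n u x⟫)) ^ 2 / (n - 1) := by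
  have hfr : Module.finrank ℝ (TangentSpace (𝓡 n) x) = n := by
    rw [Module.finrank_eq_card_basis (coordBasis x), Fintype.card_fin]
  have hn' : (Module.finrank ℝ (TangentSpace (𝓡 n) x) : ℝ) - 1 ≠ 0 := by
    have : (2 : ℝ) ≤ n := by exact_mod_cast hn
    rw [hfr]; linarith
  have h := sum_sq_tracefree_orthogonal (stdOrthonormalBasis ℝ (levelTangent n u x)) hx
    (N := unitNormal n u x) rfl (hessEnd_isSymmetric hu x) hn' ‖grad n u x‖⁻¹
  have hII (v w : levelTangent n u x) : secondFF n u x v w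
      = ‖grad n u x‖⁻¹ * ⟪hessEnd n u x (v : TangentSpace (𝓡 n) x), (w : TangentSpace (𝓡 n) x)⟫ :=
    innerCovDeriv_unitNormal hu hx _ _
      (Submodule.mem_orthogonal_singleton_iff_inner_right.1 w.2)
  simp only [normSqII₀, traceFreeII, meanCurv, hII]
  rw [hfr] at h
  exact h

end HessianEndomorphism

/-! ### The Bochner computation transferred to the manifold. -/

section LevelSetIdentity

variable {n : ℕ} {M : Type*} [TopologicalSpace M] [ChartedSpace (Coord n) M]
  [RiemannianBundle (fun x : M ↦ TangentSpace (𝓡 n) x)]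

theorem ricci_smul (x : M) (c : ℝ) (v : TangentSpace (𝓡 n) x) :
    ricci x (c • v) (c • v) = c ^ 2 * ricci x v v := by
  simp only [ricci, component_eq, map_smul, smul_eq_mul, Finset.mul_sum]
  exact Finset.sum_congr rfl fun i _ ↦ Finset.sum_congr rfl fun j _ ↦ by ring

variable [IsManifold (𝓡 n) ∞ M]
  [IsContMDiffRiemannianBundle (𝓡 n) ∞ (EuclideanSpace ℝ (Fin n))
      (fun x : M ↦ TangentSpace (𝓡 n) x)] {u : M → ℝ}

theorem component_hessEnd_grad (hu : ContMDiff (𝓡 n) 𝓘(ℝ, ℝ) ∞ u) (x : M) (i : Fin n) :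
    component x i (hessEnd n u x (grad n u x)) = ∑ j, hessMatrix n u x i j
      * localGrad (metricMatrix x) (fun y ↦ u (param x y)) j (extChartAt (𝓡 n) x x) := by
  simp only [component_hessEnd, component_grad_self (hu.mdifferentiable (by simp) x)]

/-- The chain rule for √P together with ∇P = 2A∇u gives A∇u/|∇u| = A𝐧. -/
theorem grad_norm_grad (hu : ContMDiff (𝓡 n) 𝓘(ℝ, ℝ) ∞ u) {x : M}
    (hx : grad n u x ≠ 0) :
    grad n (fun y ↦ ‖grad n u y‖) x = hessEnd n u x (unitNormal n u x) := by
  have hz := mem_extChartAt_target (I := 𝓡 n) x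
  have hg := isLocalMetric_metricMatrix (n := n) x
  have hP : localSqNormGrad n u x (extChartAt (𝓡 n) x x) ≠ 0 := by
    rw [← norm_grad_self hu]; exact pow_ne_zero _ (norm_ne_zero_iff.2 hx)
  have hnorm : ‖grad n u x‖ = √(localSqNormGrad n u x (extChartAt (𝓡 n) x x)) := by
    rw [← norm_grad_self hu, Real.sqrt_sq (norm_nonneg _)]
  have hpd i : pd i (fun y ↦ ‖grad n u (param x y)‖) (extChartAt (𝓡 n) x x)
      = 1 / (2 * ‖grad n u x‖) * pd i (localSqNormGrad n u x) (extChartAt (𝓡 n) x x) := by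
    rw [pd_congr_on hg.isOpen (fun y hy ↦ norm_grad_param hu hy) hz, hnorm]
    exact pd_comp_real (Real.hasDerivAt_sqrt hP)
      ((contDiffAt_localSqNormGrad hu x).differentiableAt (by simp)) i
  have hcomp i : component x i (grad n (fun y ↦ ‖grad n u y‖) x)
      = component x i (hessEnd n u x (unitNormal n u x)) := by
    rw [component_grad_self ((contMDiffAt_norm_grad hu hx).mdifferentiableAt (by simp)), unitNormal,
      map_smul, component_eq x i (_ • _), map_smul, ← component_eq, component_hessEnd_grad hu,
      localGrad]
    simp only [hpd, mul_left_comm _ (1 / (2 * ‖grad n u x‖)), ← Finset.mul_sum]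
    have h := hg.grad_sq_norm_grad (contDiffOn_comp_param_target hu x) hz i
    have h0 : ‖grad n u x‖ ≠ 0 := norm_ne_zero_iff.2 hx
    refine (congrArg (1 / (2 * ‖grad n u x‖) * ·) h).trans ?_
    simp only [hessMatrix, Matrix.of_apply, smul_eq_mul]
    field_simp
  refine (coordBasis x).ext_elem fun i ↦ ?_
  rw [coordBasis_repr, coordBasis_repr, hcomp]

theorem grad_sq (hu : ContMDiff (𝓡 n) 𝓘(ℝ, ℝ) ∞ u) (x : M) :
    grad n (fun y ↦ u y ^ 2) x = (2 * u x) • grad n u x := by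
  have hz := mem_extChartAt_target (I := 𝓡 n) x
  have hg := isLocalMetric_metricMatrix (n := n) x
  have hd := hu.mdifferentiable (by simp) x
  have dd := (contDiffOn_comp_param_target hu x).differentiableAt_of_isOpen hg.isOpen hz
  refine (coordBasis x).ext_elem fun i ↦ ?_
  have h2 : MDifferentiableAt (𝓡 n) 𝓘(ℝ, ℝ) (fun y ↦ u y ^ 2) x := by
    simp only [pow_two]; exact hd.mul hd
  rw [coordBasis_repr, coordBasis_repr, component_grad_self h2, component_eq, map_smul,
    ← component_eq, component_grad_self hd, localGrad, localGrad, smul_eq_mul, Finset.mul_sum]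
  refine Finset.sum_congr rfl fun j _ ↦ ?_
  simp only [pow_two]
  rw [pd_mul dd dd, param_extChartAt (mem_extChartAt_source x)]
  ring

theorem trace_hessEnd_of_laplacian_sq (hu : ContMDiff (𝓡 n) 𝓘(ℝ, ℝ) ∞ u) {x : M}
    (heq : laplacian n (fun y ↦ u y ^ 2) x = 2 * (n : ℝ) * ‖grad n u x‖ ^ 2) :
    u x * LinearMap.trace ℝ _ (hessEnd n u x) = (n - 1) * ‖grad n u x‖ ^ 2 := by
  have hz := mem_extChartAt_target (I := 𝓡 n) x
  have hg := isLocalMetric_metricMatrix (n := n) x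
  have hs := contDiffOn_comp_param_target hu x
  rw [norm_grad_self hu] at heq ⊢
  have h := hg.mul_localLaplacian_of_sq hs hz heq
  rw [hg.localLaplacian_eq_sum hs hz, param_extChartAt (mem_extChartAt_source x)] at h
  rw [trace_hessEnd]
  exact h

/-- The Laplacian of `u ^ (2 * q) * |∇u| ^ β` in terms of the Hessian of `u`. -/
theorem laplacian_rpow_mul_norm_grad_rpow (hu : ContMDiff (𝓡 n) 𝓘(ℝ, ℝ) ∞ u) (hpos : ∀ x, 0 < u x)
    (heq : ∀ x, laplacian n (fun y ↦ u y ^ 2) x = 2 * (n : ℝ) * ‖grad n u x‖ ^ 2)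
    (q s : ℝ) {x : M} (hx : grad n u x ≠ 0) :
    laplacian n (fun y ↦ u y ^ (2 * q) * ‖grad n u y‖ ^ (2 * s)) x
      = u x ^ (2 * q) * (s * (‖grad n u x‖ ^ 2) ^ (s - 1) * (2 * (
          (n - 1) * (2 * ⟪hessEnd n u x (grad n u x), grad n u x⟫ / u x
            - (‖grad n u x‖ ^ 2) ^ 2 / u x ^ 2)
          + ricci x (grad n u x) (grad n u x)
          + LinearMap.trace ℝ _ (hessEnd n u x ∘ₗ hessEnd n u x)))
          + s * (s - 1) * (‖grad n u x‖ ^ 2) ^ (s - 2)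
            * (4 * ‖hessEnd n u x (grad n u x)‖ ^ 2))
        + (‖grad n u x‖ ^ 2) ^ s
          * (2 * q * u x ^ (2 * q - 1) * ((n - 1) * ‖grad n u x‖ ^ 2 / u x)
            + 2 * q * (2 * q - 1) * u x ^ (2 * q - 2) * ‖grad n u x‖ ^ 2)
        + 8 * q * s * u x ^ (2 * q - 1) * (‖grad n u x‖ ^ 2) ^ (s - 1)
          * ⟪hessEnd n u x (grad n u x), grad n u x⟫ := by
  have hz := mem_extChartAt_target (I := 𝓡 n) x
  have hg := isLocalMetric_metricMatrix (n := n) x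
  have hs := contDiffOn_comp_param_target hu x
  have sP := contDiffOn_localSqNormGrad hu x
  have hu2 : ContMDiff (𝓡 n) 𝓘(ℝ, ℝ) ∞ (fun y ↦ u y ^ 2) := by
    simp only [pow_two]; exact hu.mul hu
  -- The chart is shrunk to where |∇u|² > 0, so that its real powers are smooth.
  set U := (extChartAt (𝓡 n) x).target ∩ localSqNormGrad n u x ⁻¹' Set.Ioi 0 with hU
  have hUo : IsOpen U := sP.continuousOn.isOpen_inter_preimage hg.isOpen isOpen_Ioi
  have hzU : extChartAt (𝓡 n) x x ∈ U := by
    refine ⟨hz, ?_⟩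
    rw [Set.mem_preimage, ← norm_grad_self hu]
    exact pow_pos (norm_pos_iff.2 hx) 2
  have key := (hg.mono hUo Set.inter_subset_left).localLaplacian_rpow_mul_rpow
    (hs.mono Set.inter_subset_left) (fun z _ ↦ hpos _) (P := localSqNormGrad n u x) (fun z ↦ rfl)
    (fun z hz ↦ hz.2) (fun z hz ↦ ?_) hzU (A := fun i j ↦ hessMatrix n u x i j) (fun i j ↦ rfl)
    (Y := fun i ↦ component x i (hessEnd n u x (grad n u x)))
    (fun i ↦ component_hessEnd_grad hu x i) q s
  · have hlap : laplacian n (fun y ↦ u y ^ (2 * q) * ‖grad n u y‖ ^ (2 * s)) x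
        = localLaplacian (metricMatrix x)
          (fun z ↦ u (param x z) ^ (2 * q) * localSqNormGrad n u x z ^ s)
          (extChartAt (𝓡 n) x x) := by
      refine IsLocalMetric.localLaplacian_congr hUo (fun z hz ↦ ?_) hzU
      beta_reduce
      rw [norm_grad_param hu hz.1, Real.rpow_mul (Real.sqrt_nonneg _), Real.rpow_two,
        Real.sq_sqrt (le_of_lt hz.2)]
    have hT : ∑ i, component x i (hessEnd n u x (grad n u x))
        * pd i (fun y ↦ u (param x y)) (extChartAt (𝓡 n) x x)
        = ⟪hessEnd n u x (grad n u x), grad n u x⟫ := by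
      rw [real_inner_comm, inner_grad_eq_sum hu]
      exact Finset.sum_congr rfl fun i _ ↦ mul_comm _ _
    have hN : ∑ i, ∑ j, metricMatrix x (extChartAt (𝓡 n) x x) i j
        * component x i (hessEnd n u x (grad n u x)) * component x j (hessEnd n u x (grad n u x))
        = ‖hessEnd n u x (grad n u x)‖ ^ 2 := by
      rw [← real_inner_self_eq_norm_sq, inner_eq_sum (mem_extChartAt_source x)]
    have hR : ∑ i, ∑ j, localRicci (localChristoffel (metricMatrix x)) i j (extChartAt (𝓡 n) x x)
          * localGrad (metricMatrix x) (fun y ↦ u (param x y)) i (extChartAt (𝓡 n) x x)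
          * localGrad (metricMatrix x) (fun y ↦ u (param x y)) j (extChartAt (𝓡 n) x x)
        = ricci x (grad n u x) (grad n u x) := by
      simp only [ricci, component_grad_self (hu.mdifferentiable (by simp) x)]
      rfl
    rw [hlap, key, hT, hN, hR, ← trace_hessEnd_comp, ← norm_grad_self hu,
      param_extChartAt (mem_extChartAt_source x)]
  -- The hypothesis at every point of U, moved from that point's own chart to the chart at x.
  · have h := heq (param x z)
    rw [laplacian_param hz.1 hu2, norm_grad_param hu hz.1, Real.sq_sqrt (le_of_lt hz.2)] at h
    exact h

end LevelSetIdentity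

/-! ### The formula in terms of the second fundamental form and B. -/

section LevelSetFormula

variable {n : ℕ} {M : Type*} [TopologicalSpace M] [ChartedSpace (Coord n) M]
  [IsManifold (𝓡 n) ∞ M] [RiemannianBundle (fun x : M ↦ TangentSpace (𝓡 n) x)]
  [IsContMDiffRiemannianBundle (𝓡 n) ∞ (EuclideanSpace ℝ (Fin n))
      (fun x : M ↦ TangentSpace (𝓡 n) x)] {u : M → ℝ}

theorem laplacian_levelSet_formula (hn : 2 ≤ n) (hu : ContMDiff (𝓡 n) 𝓘(ℝ, ℝ) ∞ u)
    (hpos : ∀ x, 0 < u x)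
    (heq : ∀ x, laplacian n (fun y ↦ u y ^ 2) x = 2 * (n : ℝ) * ‖grad n u x‖ ^ 2)
    (q β : ℝ) {x : M} (hx : grad n u x ≠ 0) :
    laplacian n (fun y ↦ u y ^ (2 * q) * ‖grad n u y‖ ^ β) x
      = 2 * q * (2 * q + n - 2) * u x ^ (2 * q - 2) * ‖grad n u x‖ ^ (2 + β)
        + β * u x ^ (2 * q) * ‖grad n u x‖ ^ β
          * (normSqII₀ n u x + ricci x (unitNormal n u x) (unitNormal n u x))
        + β / (4 * ((n : ℝ) - 1)) * u x ^ (2 * q - 2) * ‖grad n u x‖ ^ (β - 2)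
          * ((1 + (β - 1) * ((n : ℝ) - 1)) * ‖vecBn n u x‖ ^ 2
            + ((n : ℝ) - 2) * ‖vecBnTan n u x‖ ^ 2)
        + β * (2 * q + n - 2) * u x ^ (2 * q - 2) * ‖grad n u x‖ ^ (β - 1)
          * ⟪grad n (fun y ↦ ‖grad n u y‖) x, grad n (fun y ↦ u y ^ 2) x⟫ := by
  have hw : 0 < ‖grad n u x‖ := norm_pos_iff.2 hx
  have hux := hpos x
  have hG : grad n u x = ‖grad n u x‖ • unitNormal n u x := by
    rw [unitNormal, smul_smul, mul_inv_cancel₀ hw.ne', one_smul]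
  have htr := trace_hessEnd_of_laplacian_sq hu (heq x)
  have htr' : LinearMap.trace ℝ _ (hessEnd n u x) = (n - 1) * ‖grad n u x‖ ^ 2 / u x := by
    rw [← htr]; field_simp
  have key := laplacian_rpow_mul_norm_grad_rpow hu hpos heq q (β / 2) hx
  have hTG : hessEnd n u x (grad n u x) = ‖grad n u x‖ • hessEnd n u x (unitNormal n u x) := by
    conv_lhs => rw [hG, map_smul]
  have hRic : ricci x (grad n u x) (grad n u x)
      = ‖grad n u x‖ ^ 2 * ricci x (unitNormal n u x) (unitNormal n u x) := by
    conv_lhs => rw [hG, ricci_smul]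
  have hh : ⟪hessEnd n u x (unitNormal n u x), grad n u x⟫
      = ‖grad n u x‖ * ⟪hessEnd n u x (unitNormal n u x), unitNormal n u x⟫ := by
    conv_lhs => rw [hG, inner_smul_right]
  rw [show 2 * (β / 2) = β by ring, hTG, hRic, inner_smul_left, hh, norm_smul, norm_norm, mul_pow]
    at key
  rw [key, grad_norm_grad hu hx, grad_sq hu, inner_smul_right, hh, sq_norm_vecBn hu hx,
    sq_norm_vecBnTan hu hx, normSqII₀_eq hn hu hx, htr']
  simp only [conj_trivial]
  -- From here on only an identity between real numbers is left.
  generalize LinearMap.trace ℝ _ (hessEnd n u x ∘ₗ hessEnd n u x) = t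
  generalize ⟪hessEnd n u x (unitNormal n u x), unitNormal n u x⟫ = h
  generalize ‖hessEnd n u x (unitNormal n u x)‖ = a
  generalize ricci x (unitNormal n u x) (unitNormal n u x) = r
  generalize ‖grad n u x‖ = w at hw ⊢
  generalize u x = v at hux ⊢
  have hn1 : (n : ℝ) - 1 ≠ 0 := by
    have : (2 : ℝ) ≤ n := by exact_mod_cast hn
    linarith
  -- All powers are reduced to v^{2q-2} and w^{β-2}; with these as free variables the identity is
  -- rational.
  have v1 : v ^ (2 * q) = v ^ (2 * q - 2) * v ^ 2 := by
    rw [← Real.rpow_natCast v 2, ← Real.rpow_add hux]; congr 1; push_cast; ring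
  have v2 : v ^ (2 * q - 1) = v ^ (2 * q - 2) * v := by
    rw [← Real.rpow_add_one hux.ne']; congr 1; ring
  have w0 (s : ℝ) : (w ^ 2) ^ s = w ^ (2 * s) := by
    rw [Real.rpow_mul hw.le, Real.rpow_two]
  have w1 : w ^ β = w ^ (β - 2) * w ^ 2 := by
    rw [← Real.rpow_natCast w 2, ← Real.rpow_add hw]; congr 1; push_cast; ring
  have w2 : w ^ (β - 1) = w ^ (β - 2) * w := by
    rw [← Real.rpow_add_one hw.ne']; congr 1; ring
  have w3 : w ^ (2 + β) = w ^ (β - 2) * w ^ 4 := by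
    rw [← Real.rpow_natCast w 4, ← Real.rpow_add hw]; congr 1; push_cast; ring
  have w4 : w ^ (β - 4) = w ^ (β - 2) / w ^ 2 := by
    rw [← Real.rpow_natCast w 2, ← Real.rpow_sub hw]; congr 1; push_cast; ring
  rw [w0, w0, w0, show 2 * (β / 2) = β by ring, show 2 * (β / 2 - 1) = β - 2 by ring,
    show 2 * (β / 2 - 2) = β - 4 by ring, v1, v2, w1, w2, w3, w4]
  generalize v ^ (2 * q - 2) = c
  generalize w ^ (β - 2) = d
  field_simp
  ring

theorem contMDiffAt_rpow_mul_norm_grad_rpow (hu : ContMDiff (𝓡 n) 𝓘(ℝ, ℝ) ∞ u)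
    (hpos : ∀ x, 0 < u x) (s β : ℝ) {x : M} (hx : grad n u x ≠ 0) :
    ContMDiffAt (𝓡 n) 𝓘(ℝ, ℝ) ∞ (fun y ↦ u y ^ s * ‖grad n u y‖ ^ β) x :=
  ((Real.contDiffAt_rpow_const_of_ne (p := s) (hpos x).ne').contMDiffAt.comp x
    hu.contMDiffAt).mul
  ((Real.contDiffAt_rpow_const_of_ne (p := β) (norm_ne_zero_iff.2 hx)).contMDiffAt.comp x
    (contMDiffAt_norm_grad hu hx))

end LevelSetFormula

end LevelSetGeometry

theorem propositionp {n : ℕ} (hn : 2 ≤ n) {M : Type*} [TopologicalSpace M]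
    [ChartedSpace (EuclideanSpace ℝ (Fin n)) M] [IsManifold (𝓡 n) ∞ M]
    [RiemannianBundle (fun x : M ↦ TangentSpace (𝓡 n) x)]
    [IsContMDiffRiemannianBundle (𝓡 n) ∞ (EuclideanSpace ℝ (Fin n))
      (fun x : M ↦ TangentSpace (𝓡 n) x)]
    (u : M → ℝ) (hu : ContMDiff (𝓡 n) 𝓘(ℝ, ℝ) ∞ u) (hpos : ∀ x, 0 < u x)
    (heq : ∀ x, laplacian n (fun y ↦ u y ^ 2) x
      = 2 * (n : ℝ) * ‖grad n u x‖ ^ 2)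
    (q β : ℝ) (x : M) (hx : grad n u x ≠ 0) :
    ContMDiffAt (𝓡 n) 𝓘(ℝ, ℝ) ∞
      (fun y ↦ u y ^ (2 * q) * ‖grad n u y‖ ^ β) x ∧
    laplacian n (fun y ↦ u y ^ (2 * q) * ‖grad n u y‖ ^ β) x
      = 2 * q * (2 * q + n - 2) * u x ^ (2 * q - 2) * ‖grad n u x‖ ^ (2 + β)
        + β * u x ^ (2 * q) * ‖grad n u x‖ ^ β
          * (normSqII₀ n u x
            + ricci x (unitNormal n u x)
                (unitNormal n u x))
        + β / (4 * ((n : ℝ) - 1)) * u x ^ (2 * q - 2) * ‖grad n u x‖ ^ (β - 2)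
          * ((1 + (β - 1) * ((n : ℝ) - 1)) * ‖vecBn n u x‖ ^ 2
            + ((n : ℝ) - 2) * ‖vecBnTan n u x‖ ^ 2)
        + β * (2 * q + n - 2) * u x ^ (2 * q - 2) * ‖grad n u x‖ ^ (β - 1)
          * ⟪grad n (fun y ↦ ‖grad n u y‖) x,
              grad n (fun y ↦ u y ^ 2) x⟫ ∧
    laplacian n
        (fun y ↦ u y ^ (2 - (n : ℝ)) * ‖grad n u y‖ ^ β) x
      = β * u x ^ (2 - (n : ℝ)) * ‖grad n u x‖ ^ β
          * (normSqII₀ n u x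
            + ricci x (unitNormal n u x)
                (unitNormal n u x))
        + β / (4 * ((n : ℝ) - 1)) * u x ^ (-(n : ℝ)) * ‖grad n u x‖ ^ (β - 2)
          * ((1 + (β - 1) * ((n : ℝ) - 1)) * ‖vecBn n u x‖ ^ 2
            + ((n : ℝ) - 2) * ‖vecBnTan n u x‖ ^ 2) ∧
    laplacian n (fun y ↦ ‖grad n u y‖ ^ β) x
      = β * ‖grad n u x‖ ^ β
          * (normSqII₀ n u x
            + ricci x (unitNormal n u x)
                (unitNormal n u x))
        + β * ((n : ℝ) - 2) * u x ^ (-2 : ℝ) * ‖grad n u x‖ ^ (β - 1)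
          * ⟪grad n (fun y ↦ ‖grad n u y‖) x,
              grad n (fun y ↦ u y ^ 2) x⟫
        + β / (4 * ((n : ℝ) - 1)) * u x ^ (-2 : ℝ) * ‖grad n u x‖ ^ (β - 2)
          * ((1 + (β - 1) * ((n : ℝ) - 1)) * ‖vecBn n u x‖ ^ 2
            + ((n : ℝ) - 2) * ‖vecBnTan n u x‖ ^ 2) := by
  refine ⟨contMDiffAt_rpow_mul_norm_grad_rpow hu hpos _ _ hx,
    laplacian_levelSet_formula hn hu hpos heq q β hx, ?_, ?_⟩
  -- For 2q = 2 - n the factor 2q+n-2 vanishes in both terms that contain it.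
  · have h := laplacian_levelSet_formula hn hu hpos heq ((2 - n) / 2) β hx
    rw [show 2 * ((2 - (n : ℝ)) / 2) = 2 - n by ring] at h
    rw [h, show 2 - (n : ℝ) - 2 = -n by ring]
    ring
  · have h := laplacian_levelSet_formula hn hu hpos heq 0 β hx
    simp only [mul_zero, Real.rpow_zero, one_mul, zero_sub, zero_mul, zero_add, mul_one] at h
    rw [h]
    ring
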